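/- All digraphs are finite and without loops or parallel edges. For a digraph $G$ and $X\subseteq V(G)$, a *component* of $G-X$ is (the vertex set of) a strongly connected component of $G-X$, and $\mathrm{Reach}_{G-X}(R)$ is the set of vertices reachable from $R$ by directed paths in $G-X$. *Games.* A position is a pair $(C,R)$ with $C\subseteq V(G)$ (the cops) and $R$ a component of $G-C$ (the robber). A play starts with $C_0=\emptyset$ and a component $R_0$ of $G$ chosen by the robber. In each round the cops, knowing the play so far, announce a set $C'$; then the robber moves to a component $R'$ of $G-C'$. In the *directed tree-width game*, $R$ and $R'$ must be contained in the same component of $G-(C\cap C')$; in the *DAG-width game*, $R'$ must be reachable from $R$ by a directed path in $G-(C\cap C')$. The robber is captured when he has no legal move. A strategy of the cops is *winning* if every play consistent with it ends with the capture of the robber; it is a strategy for $k$ cops if $|C_i|\le k$ always. It is *cop-monotone* if in every consistent play $C_i\cap C_l\subseteq C_j$ for all $i<j<l$ (including the last announced cop set). It is *robber-monotone* if in every consistent play, for all $i$, $R_{i+1}\subseteq R_i$ (directed tree-width game), respectively $\mathrm{Reach}_{G-C_{i+1}}(R_{i+1})\subseteq \mathrm{Reach}_{G-C_i}(R_i)$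 (DAG-width game). *Kelly-width.* For a linear order $\vartriangleleft$ on $V(G)$, the support of $v$ is the set of all $u$ with $v\vartriangleleft u$ such that there is an edge $(v',u)$ with $v'$ reachable from $v$ in $G-\{w : v\vartriangleleft w\}$. The width of $\vartriangleleft$ is the maximal size of a support, and the Kelly-width $\mathrm{KW}(G)$ is one plus the minimal width of a linear order on $V(G)$. *D-width.* A D-decomposition of $G$ is a finite rooted tree $T$ with sets $X_t\subseteq V(G)$, $t\in V(T)$, such that $\bigcup_t X_t=V(G)$ and, for every nonempty strongly connected set $S\subseteq V(G)$, the nodes $t$ with $X_t\cap S\ne\emptyset$ induce a connected subtree of $T$. Its width is $\max_t|X_t|$, and the D-width $\mathrm{DW}(G)$ is the minimal width of a D-decomposition of $G$. **Theorem.** There is a family of digraphs $(G_n)_{n\in\mathbb N}$ such that for every $n$: 1. $3$ cops have a winning strategy in the directed tree-width game on $G_n$ that is both cop- and robber-monotone; 2. $4$ cops have a winning strategy in the DAG-width game on $G_n$ that is both cop- and robber-monotone; 3. $\mathrm{KW}(G_n)=4$; 4. $\mathrm{DW}(G_n)\ge n$. -/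

import Mathlib

namespace DigraphWidth

variable {V : Type}

/-- `Reaches G X u v`: there is a directed path from `u` to `v` in `G - X`
(in particular `u` and `v` are vertices of `G - X`). -/
def Reaches (G : Digraph V) (X : Set V) (u v : V) : Prop :=
  u ∉ X ∧ Relation.ReflTransGen (fun a b => G.Adj a b ∧ b ∉ X) u v

/-- The set of vertices reachable in `G - X` from the vertices of `R`. -/
def reachSet (G : Digraph V) (X R : Set V) : Set V :=
  {w | ∃ u ∈ R, Reaches G X u w}

/-- `R` is (the vertex set of) a strongly connected component of `G - X`. -/
def IsComponent (G : Digraph V) (X R : Set V) : Prop :=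
  ∃ v, v ∉ X ∧ R = {u | Reaches G X v u ∧ Reaches G X u v}

/-- `S` is a (nonempty) strongly connected set of vertices: any two of its vertices are joined by
directed paths inside the induced subgraph `G[S] = G - Sᶜ`. -/
def IsStronglyConnectedSet (G : Digraph V) (S : Set V) : Prop :=
  S.Nonempty ∧ ∀ u ∈ S, ∀ v ∈ S, Reaches G Sᶜ u v

/-! ### Graph searching games -/

/-- A position in which the cops are to move: the set `C` of vertices occupied by the cops and the
robber component `R`, a strong component of `G - C`. -/
abbrev CopPosition (V : Type) := Set V × Set V

/-- Robber moves in the reachability game: when the cops move from `C` to `C'`, the robber moves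
from `R` to a component `R'` of `G - C'` which is reachable from `R` in `G - (C ∩ C')`. -/
def ReachMove (G : Digraph V) (C C' R R' : Set V) : Prop :=
  IsComponent G C' R' ∧ ∃ u ∈ R, ∃ w ∈ R', Reaches G (C ∩ C') u w

/-- Robber moves in the component game: when the cops move from `C` to `C'`, the robber moves
from `R` to a component `R'` of `G - C'` such that `R` and `R'` are contained in the same component
of `G - (C ∩ C')`. -/
def CompMove (G : Digraph V) (C C' R R' : Set V) : Prop :=
  IsComponent G C' R' ∧ ∃ K, IsComponent G (C ∩ C') K ∧ R ⊆ K ∧ R' ⊆ K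

/-- A step from `(C, R)` to `(C', R')` is robber-monotone in the reachability game: no vertex
becomes available to the robber that he could not reach before. -/
def ReachRobberMono (G : Digraph V) (C C' R R' : Set V) : Prop :=
  reachSet G C' R' ⊆ reachSet G C R

/-- A step from `(C, R)` to `(C', R')` is robber-monotone in the component game. -/
def CompRobberMono (_G : Digraph V) (_C _C' R R' : Set V) : Prop :=
  R' ⊆ R

/-- A cop strategy maps the history `(C₀, R₀), …, (Cᵢ, Rᵢ)` of a play to the next set `Cᵢ₊₁` of
vertices to be occupied by the cops. -/
abbrev CopStrategy (V : Type) := List (CopPosition V) → Set V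

/-- The history `(C₀, R₀), …, (Cᵢ, Rᵢ)` of the play `p`. -/
def history (p : ℕ → CopPosition V) (i : ℕ) : List (CopPosition V) :=
  (List.range (i + 1)).map p

/-- The first `m` rounds of `p` form a play consistent with the cop strategy `σ`, where `move` is
the rule for the robber moves. A play starts with no cops on the graph and with a component of `G`
chosen by the robber. -/
def IsPlay (G : Digraph V) (move : Digraph V → Set V → Set V → Set V → Set V → Prop)
    (σ : CopStrategy V) (p : ℕ → CopPosition V) (m : ℕ) : Prop :=
  (p 0).1 = ∅ ∧ IsComponent G ∅ (p 0).2 ∧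
    ∀ i < m, (p (i + 1)).1 = σ (history p i) ∧
      move G (p i).1 (p (i + 1)).1 (p i).2 (p (i + 1)).2

/-- `k` cops have a cop- and robber-monotone winning strategy: in every consistent play
* the strategy never uses more than `k` cops,
* the play is cop-monotone, `Cᵢ ∩ Cₗ ⊆ Cⱼ` for all `i < j < l` (here `l = m + 1`, so that also the
  last cop move, to which the robber has no answer, is taken into account),
* the play is robber-monotone,

and no consistent play is infinite, that is, every play ends in a position where the robber has no
legal move and is captured. -/
def HasMonotoneWinningStrategy (G : Digraph V)
    (move mono : Digraph V → Set V → Set V → Set V → Set V → Prop) (k : ℕ) [Finite V] : Prop :=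
  ∃ σ : CopStrategy V,
    (∀ p m, IsPlay G move σ p m →
      (σ (history p m)).ncard ≤ k ∧
      (∀ i j, i < j → j ≤ m → (p i).1 ∩ σ (history p m) ⊆ (p j).1) ∧
      (∀ i < m, mono G (p i).1 (p (i + 1)).1 (p i).2 (p (i + 1)).2)) ∧
    ¬ ∃ p, ∀ m, IsPlay G move σ p m

/-- `k` cops have a cop- and robber-monotone winning strategy in the directed tree-width game
(the component game). -/
def CopsWinDirectedTreeWidthGame (G : Digraph V) (k : ℕ) [Finite V] : Prop :=
  HasMonotoneWinningStrategy G CompMove CompRobberMono k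

/-- `k` cops have a cop- and robber-monotone winning strategy in the DAG-width game
(the reachability game). -/
def CopsWinDAGWidthGame (G : Digraph V) (k : ℕ) [Finite V] : Prop :=
  HasMonotoneWinningStrategy G ReachMove ReachRobberMono k

/-! ### Kelly-width -/

/-- The support of `v` with respect to the elimination order `L`: all `u` greater than `v` that are
heads of edges whose tail is reachable from `v` without visiting vertices greater than `v`. -/
def support (G : Digraph V) (L : LinearOrder V) (v : V) : Set V :=
  {u | L.lt v u ∧ ∃ v', Reaches G {w | L.lt v w} v v' ∧ G.Adj v' u}

/-- The width of an elimination order: the maximal size of a support. -/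
noncomputable def eliminationWidth [Fintype V] (G : Digraph V) (L : LinearOrder V) : ℕ :=
  Finset.univ.sup fun v => (support G L v).ncard

/-- The Kelly-width: one plus the minimal width of an elimination order. -/
noncomputable def kellyWidth [Fintype V] (G : Digraph V) : ℕ :=
  1 + sInf {w | ∃ L : LinearOrder V, eliminationWidth G L = w}

/-! ### D-width -/

/-- A D-decomposition of `G`: a finite rooted tree (a tree whose edges are oriented away from
`root`, given by its underlying undirected tree and its root) with a bag of vertices of `G` for
each node, such that the bags cover `G` and, for each strongly connected set `S`, the nodes whose
bags meet `S` induce a connected subtree. -/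
structure DDecomposition (G : Digraph V) where
  Node : Type
  [fintypeNode : Fintype Node]
  tree : SimpleGraph Node
  isTree : tree.IsTree
  root : Node
  bag : Node → Set V
  cover : ∀ v, ∃ t, v ∈ bag t
  connected : ∀ S, IsStronglyConnectedSet G S →
    (tree.induce {t | (bag t ∩ S).Nonempty}).Connected

attribute [instance] DDecomposition.fintypeNode

/-- The width of a D-decomposition: the maximal size of a bag. -/
noncomputable def DDecomposition.width [Finite V] {G : Digraph V} (D : DDecomposition G) : ℕ :=
  Finset.univ.sup fun t => (D.bag t).ncard

/-- The D-width: the minimal width of a D-decomposition. -/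
noncomputable def dWidth [Finite V] (G : Digraph V) : ℕ :=
  sInf {w | ∃ D : DDecomposition G, D.width = w}

end DigraphWidth

/-!
The digraphs are disjoint unions of a nested digraph and a digraph on five vertices.

In the nested digraph, every region consists of a bidirected path with `n` vertices and of
subregions, one for each pair `i < j` of vertices of the path, nested to depth `n`. A subregion is
entered from the `i`-th vertex of the path, by edges to all of its vertices, including those of
deeper levels. It is left only to the `i`-th vertex, which keeps it strongly connected with that
vertex, and to the `j`-th vertex, its exit.

The cops search the path of a region in its order, while they guard its exit and the last occupied
vertex. When the robber has slipped into a subregion, the `j`-th vertex has to be occupied before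
the subregion is searched in the same way. In the component game this is done at once with three
cops, since a subregion cannot be re-entered from the later part of the path. In the reachability
game, four cops walk from the `i`-th to the `j`-th vertex. Such strategies are given by finitely
many states (`CompCertificate`, `ReachCertificate`), in which a zone of vertices shrinks; this
yields both kinds of monotonicity. The same separations bound the supports of an elimination order
by `2`. The digraph on five vertices has minimum outdegree `3`, which raises the Kelly-width to
exactly `4`, and three and four cops, respectively, suffice on it as well.

For the D-width, let a decomposition of the nested digraph have width less than `n`. The `i`-th
vertex of a path together with the subregions attached to it forms a strongly connected set, and
these sets are disjoint. If each subregion shared a bag with its exit, then the subtrees of these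
sets would intersect pairwise, and by the Helly property some bag would meet all `n` of them. So
there is a subregion that shares no bag with its exit (`exists_region_separated`), and this choice
can be iterated to depth `n` (`exists_nested_separated`). Let `e` be the node of the subtree of
the innermost region that is closest to the subtree of its exit (`exists_gate`). Every strongly
connected set that contains the exit and meets the region meets the bag of `e`. This applies to
the closed walks that start at a vertex `r` of the innermost path, lead through exits to one of
the `n` surrounding paths, along that path and back to `r` (`loopSet`). The bag of `e` contains no
exits, and it misses some `r`, so it contains a vertex of each of the `n` surrounding paths
(`le_width_nestedDigraph`).
-/

namespace DigraphWidth

variable {V : Type}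

/-! ### Strategies from certificates -/

theorem history_succ (p : ℕ → CopPosition V) (m : ℕ) :
    history p (m + 1) = history p m ++ [p (m + 1)] := by
  simp [history, List.range_succ]

theorem IsPlay.of_succ {G : Digraph V} {move : Digraph V → Set V → Set V → Set V → Set V → Prop}
    {σ : CopStrategy V} {p : ℕ → CopPosition V} {m : ℕ} (h : IsPlay G move σ p (m + 1)) :
    IsPlay G move σ p m :=
  ⟨h.1, h.2.1, fun i hi => h.2.2 i (hi.trans (Nat.lt_succ_self m))⟩

/-- A monotone strategy from finitely presented information. The cops keep track of a state `s`;
they keep the vertices of `guard s` occupied and occupy `next s` as well. The robber stays in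
`terr s`, and all vertices to be occupied from then on lie in `zone s`. As the zones shrink and a
vertex is removed from the zone as soon as it is occupied, no vertex is occupied twice. -/
theorem hasMonotoneWinningStrategy_of_states [Finite V] {G : Digraph V}
    {move mono : Digraph V → Set V → Set V → Set V → Set V → Prop} {k : ℕ}
    (hmove : ∀ C C' R R', move G C C' R R' → IsComponent G C' R')
    {S : Type} (guard zone terr : S → Set V) (next : S → V)
    (hcard : ∀ s, (insert (next s) (guard s)).ncard ≤ k)
    (hnext : ∀ s, next s ∈ zone s)
    (start : ∀ R, IsComponent G ∅ R → ∃ s, guard s = ∅ ∧ R ⊆ terr s)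
    (step : ∀ s C R R', guard s ⊆ C → Disjoint C (zone s) → IsComponent G C R → R ⊆ terr s →
      move G C (insert (next s) (guard s)) R R' →
      mono G C (insert (next s) (guard s)) R R' ∧
      ∃ s', guard s' ⊆ insert (next s) (guard s) ∧ zone s' ⊆ zone s \ {next s} ∧ R' ⊆ terr s') :
    HasMonotoneWinningStrategy G move mono k := by
  classical
  by_cases hS : Nonempty S
  swap
  · have key : ∀ (σ : CopStrategy V) p m, ¬ IsPlay G move σ p m := by
      intro σ p m h
      obtain ⟨s, -⟩ := start _ h.2.1
      exact hS ⟨s⟩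
    exact ⟨fun _ => ∅, fun p m h => (key _ p m h).elim, fun ⟨p, hp⟩ => key _ p 0 (hp 0)⟩
  -- The strategy keeps track of a state, which is updated by a choice after every robber move.
  let init : Set V → S := fun R => Classical.epsilon fun s => guard s = ∅ ∧ R ⊆ terr s
  let upd : S → CopPosition V → S := fun s q => Classical.epsilon fun s' =>
    guard s' ⊆ insert (next s) (guard s) ∧ zone s' ⊆ zone s \ {next s} ∧ q.2 ⊆ terr s'
  let st : List (CopPosition V) → S := fun l => match l with
    | [] => Classical.choice hS
    | q :: l => l.foldl upd (init q.2)
  let σ : CopStrategy V := fun l => insert (next (st l)) (guard (st l))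
  have st_zero (p : ℕ → CopPosition V) : st (history p 0) = init (p 0).2 := by
    simp [history, st, List.range_succ]
  have st_succ (p : ℕ → CopPosition V) (m : ℕ) :
      st (history p (m + 1)) = upd (st (history p m)) (p (m + 1)) := by
    rw [history_succ]
    obtain ⟨q, l, hl⟩ : ∃ q l, history p m = q :: l := by
      refine List.exists_cons_of_ne_nil ?_
      simp [history]
    rw [hl]
    simp [st, List.foldl_append]
  -- Along a play, the state describes the current position.
  have inv : ∀ p m, IsPlay G move σ p m →
      guard (st (history p m)) ⊆ (p m).1 ∧ Disjoint (p m).1 (zone (st (history p m))) ∧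
      IsComponent G (p m).1 (p m).2 ∧ (p m).2 ⊆ terr (st (history p m)) := by
    intro p m
    induction m with
    | zero =>
      intro h
      have h0 := Classical.epsilon_spec (start _ h.2.1)
      rw [st_zero, h.1]
      exact ⟨h0.1.le, Set.empty_disjoint _, h.2.1, h0.2⟩
    | succ m ih =>
      intro h
      obtain ⟨h1, h2, h3, h4⟩ := ih h.of_succ
      obtain ⟨e, hm⟩ := h.2.2 m (Nat.lt_succ_self m)
      rw [e] at hm
      obtain ⟨-, hs⟩ := step _ _ _ _ h1 h2 h3 h4 hm
      obtain ⟨g1, g2, g3⟩ := Classical.epsilon_spec hs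
      rw [st_succ, e]
      refine ⟨g1, ?_, hmove _ _ _ _ hm, g3⟩
      rw [Set.disjoint_left]
      rintro x (rfl | hx) hz
      · exact (g2 hz).2 rfl
      · exact Set.disjoint_left.1 h2 (h1 hx) (g2 hz).1
  have upd_spec : ∀ p m, IsPlay G move σ p (m + 1) →
      mono G (p m).1 (p (m + 1)).1 (p m).2 (p (m + 1)).2 ∧
      guard (st (history p (m + 1))) ⊆
        insert (next (st (history p m))) (guard (st (history p m))) ∧
      zone (st (history p (m + 1))) ⊆ zone (st (history p m)) \ {next (st (history p m))} := by
    intro p m h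
    obtain ⟨h1, h2, h3, h4⟩ := inv p m h.of_succ
    obtain ⟨e, hm⟩ := h.2.2 m (Nat.lt_succ_self m)
    rw [e] at hm
    obtain ⟨hmono, hs⟩ := step _ _ _ _ h1 h2 h3 h4 hm
    obtain ⟨g1, g2, g3⟩ := Classical.epsilon_spec hs
    rw [st_succ]
    refine ⟨?_, g1, g2⟩
    rw [e]
    exact hmono
  have play_mono : ∀ p m n, n ≤ m → IsPlay G move σ p m → IsPlay G move σ p n := fun p m n hn h =>
    ⟨h.1, h.2.1, fun i hi => h.2.2 i (hi.trans_le hn)⟩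
  refine ⟨σ, fun p m h => ⟨hcard _, fun i j hij hjm => ?_, fun i hi =>
    (upd_spec p i (play_mono p m _ hi h)).1⟩, ?_⟩
  · rintro x ⟨hxi, hxm⟩
    -- A vertex that was occupied once never belongs to the zone again, so it cannot be re-occupied.
    have hz : ∀ l, i ≤ l → l ≤ m → x ∉ zone (st (history p l)) := by
      intro l hil
      induction l, hil using Nat.le_induction with
      | base =>
        intro hl hx
        exact Set.disjoint_left.1 (inv p i (play_mono p m i hl h)).2.1 hxi hx
      | succ l hil ih =>
        intro hl hx
        exact ih (by omega) ((upd_spec p l (play_mono p m _ hl h)).2.2 hx).1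
    have hg : ∀ e, e ≤ m - i → x ∈ guard (st (history p (m - e))) := by
      intro e
      induction e with
      | zero =>
        intro _
        rcases hxm with hx | hx
        · exact (hz m (by omega) le_rfl (hx ▸ hnext _)).elim
        · exact hx
      | succ e ih =>
        intro he
        have h1 := ih (by omega)
        have e1 : m - e = (m - (e + 1)) + 1 := by omega
        rw [e1] at h1
        rcases (upd_spec p (m - (e + 1)) (play_mono p m _ (by omega) h)).2.1 h1 with hx | hx
        · exact (hz (m - (e + 1)) (by omega) (by omega) (hx ▸ hnext _)).elim
        · exact hx
    have := hg (m - j) (by omega)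
    rw [Nat.sub_sub_self hjm] at this
    exact (inv p j (play_mono p m j hjm h)).1 this
  · rintro ⟨p, hp⟩
    have hlt : ∀ m, (zone (st (history p (m + 1)))).ncard < (zone (st (history p m))).ncard := by
      intro m
      refine Set.ncard_lt_ncard ⟨fun x hx => ((upd_spec p m (hp _)).2.2 hx).1, fun hsub => ?_⟩
        (Set.toFinite _)
      exact ((upd_spec p m (hp _)).2.2 (hsub (hnext _))).2 rfl
    have hle : ∀ m, (zone (st (history p m))).ncard + m ≤ (zone (st (history p 0))).ncard := by
      intro m
      induction m with
      | zero => simp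
      | succ m ih => have := hlt m; omega
    have := hle ((zone (st (history p 0))).ncard + 1)
    omega

theorem Reaches.refl {G : Digraph V} {X : Set V} {v : V} (h : v ∉ X) : Reaches G X v v :=
  ⟨h, .refl⟩

theorem Reaches.trans {G : Digraph V} {X : Set V} {u v w : V} (h : Reaches G X u v)
    (h' : Reaches G X v w) : Reaches G X u w :=
  ⟨h.1, h.2.trans h'.2⟩

theorem Reaches.anti {G : Digraph V} {X Y : Set V} {u v : V} (h : Reaches G X u v) (hYX : Y ⊆ X) :
    Reaches G Y u v :=
  ⟨fun hu => h.1 (hYX hu), h.2.lift id fun _ _ hab => ⟨hab.1, fun hb => hab.2 (hYX hb)⟩⟩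

/-- A set that is left only through `X` contains all vertices that are reachable from it
outside `X`. -/
theorem Reaches.mem_of_closed {G : Digraph V} {X Z : Set V} {u v : V} (h : Reaches G X u v)
    (hZ : ∀ a ∈ Z, ∀ b, G.Adj a b → b ∈ Z ∪ X) (hu : u ∈ Z) : v ∈ Z := by
  obtain ⟨-, h2⟩ := h
  induction h2 with
  | refl => exact hu
  | tail _ hab ih => exact (hZ _ ih _ hab.1).resolve_right hab.2

/-- A path of `G - X` that starts in a set left only through `X` avoids every set `Y` disjoint from
that set. -/
theorem Reaches.of_closed {G : Digraph V} {X Y Z : Set V} {u v : V} (h : Reaches G X u v)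
    (hZ : ∀ a ∈ Z, ∀ b, G.Adj a b → b ∈ Z ∪ X) (hu : u ∈ Z) (hY : Disjoint Y Z) :
    Reaches G Y u v := by
  obtain ⟨h1, h2⟩ := h
  refine ⟨Set.disjoint_right.1 hY hu, ?_⟩
  induction h2 with
  | refl => exact .refl
  | @tail b c h3 hab ih =>
    have hb : c ∈ Z := Reaches.mem_of_closed ⟨h1, h3.tail hab⟩ hZ hu
    exact ih.tail ⟨hab.1, Set.disjoint_right.1 hY hb⟩

theorem IsComponent.reaches {G : Digraph V} {X R : Set V} (h : IsComponent G X R) {u v : V}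
    (hu : u ∈ R) (hv : v ∈ R) : Reaches G X u v := by
  obtain ⟨c, -, rfl⟩ := h
  exact hu.2.trans hv.1

theorem IsComponent.nonempty {G : Digraph V} {X R : Set V} (h : IsComponent G X R) :
    R.Nonempty := by
  obtain ⟨c, hc, rfl⟩ := h
  exact ⟨c, .refl hc, .refl hc⟩

theorem IsComponent.mem {G : Digraph V} {X R : Set V} (h : IsComponent G X R) {u v : V}
    (hu : u ∈ R) (huv : Reaches G X u v) (hvu : Reaches G X v u) : v ∈ R := by
  obtain ⟨c, -, rfl⟩ := h
  exact ⟨hu.1.trans huv, hvu.trans hu.2⟩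

/-- A component is strongly connected as an induced subgraph. -/
theorem IsComponent.reaches_compl {G : Digraph V} {X R : Set V} (h : IsComponent G X R) {u v : V}
    (hu : u ∈ R) (hv : v ∈ R) : Reaches G Rᶜ u v := by
  have h1 : Reaches G X u v := h.reaches hu hv
  refine ⟨fun hc => hc hu, ?_⟩
  have h2 := h1.2
  -- The whole path lies in the component, as its end point leads back to `u`.
  induction h2 using Relation.ReflTransGen.head_induction_on with
  | refl => exact .refl
  | @head a c hac hcv ih =>
    have ha : Reaches G X a c := ⟨h1.1, .single hac⟩
    have hc : Reaches G X c v := ⟨hac.2, hcv⟩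
    have hcR : c ∈ R := h.mem hu ha (hc.trans (h.reaches hv hu))
    exact .head ⟨hac.1, fun hn => hn hcR⟩ (ih hcR hc)

/-- A certificate for a monotone strategy of `k` cops in the reachability game. In a state `s`, the
robber lives in `zone s`, which he can leave only through the vertices of `guard s`; the cops keep
`guard s` and occupy the vertex `next s` of the zone. -/
structure ReachCertificate (G : Digraph V) (k : ℕ) where
  State : Type
  guard : State → Set V
  zone : State → Set V
  next : State → V
  card_le : ∀ s, (insert (next s) (guard s)).ncard ≤ k
  next_mem : ∀ s, next s ∈ zone s
  closed : ∀ s, ∀ a ∈ zone s, ∀ b, G.Adj a b → b ∈ zone s ∪ guard s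
  start : ∀ w, ∃ s, guard s = ∅ ∧ w ∈ zone s
  step : ∀ s, ∀ w ∈ zone s, w ≠ next s → ∃ s', guard s' ⊆ insert (next s) (guard s) ∧
    zone s' ⊆ zone s \ {next s} ∧ w ∈ zone s'

theorem ReachCertificate.copsWin [Finite V] {G : Digraph V} {k : ℕ} (c : ReachCertificate G k) :
    CopsWinDAGWidthGame G k := by
  have sub : ∀ s C R, guard c s ⊆ C → Disjoint C (c.zone s) → IsComponent G C R →
      ∀ w ∈ R, w ∈ c.zone s → R ⊆ c.zone s := by
    intro s C R hg hd hR w hw hwz x hx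
    exact ((hR.reaches hw hx).anti hg).mem_of_closed (c.closed s) hwz
  refine hasMonotoneWinningStrategy_of_states (fun _ _ _ _ h => h.1) c.guard c.zone c.zone c.next
    c.card_le c.next_mem ?_ ?_
  · intro R hR
    obtain ⟨w, hw⟩ := hR.nonempty
    obtain ⟨s, hs, hws⟩ := c.start w
    exact ⟨s, hs, sub s ∅ R hs.le (Set.empty_disjoint _) hR w hw hws⟩
  · rintro s C R R' hg hd hR hRz ⟨hR', u, hu, w, hw, huw⟩
    have huw' : Reaches G (c.guard s) u w :=
      huw.anti (Set.subset_inter hg (Set.subset_insert _ _))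
    have hwz : w ∈ c.zone s := huw'.mem_of_closed (c.closed s) (hRz hu)
    have hR'sub : R' ⊆ c.zone s := fun x hx =>
      (((hR'.reaches hw hx).anti (Set.subset_insert _ _)).mem_of_closed (c.closed s) hwz)
    refine ⟨?_, ?_⟩
    · rintro z ⟨y, hy, hyz⟩
      refine ⟨u, hu, ?_⟩
      have h1 : Reaches G (c.guard s) u z :=
        (huw'.trans ((hR'.reaches hw hy).anti (Set.subset_insert _ _))).trans
          (hyz.anti (Set.subset_insert _ _))
      exact h1.of_closed (c.closed s) (hRz hu) hd
    · have hne : w ≠ c.next s := fun h => (hR'.reaches hw hw).1 (h ▸ Set.mem_insert _ _)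
      obtain ⟨s', h1, h2, h3⟩ := c.step s w hwz hne
      refine ⟨s', h1, h2, fun x hx => ?_⟩
      exact ((hR'.reaches hw hx).anti h1).mem_of_closed (c.closed s') h3

/-- A certificate for a monotone strategy of `k` cops in the component game. In a state `s`, the
robber lives in `terr s`, a union of strong components of `G - guard s`. All vertices that the cops
occupy from then on lie in `zone s`; these need not belong to `terr s`. -/
structure CompCertificate (G : Digraph V) (k : ℕ) where
  State : Type
  guard : State → Set V
  zone : State → Set V
  terr : State → Set V
  next : State → V
  card_le : ∀ s, (insert (next s) (guard s)).ncard ≤ k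
  next_mem : ∀ s, next s ∈ zone s
  terr_subset : ∀ s, terr s ⊆ zone s
  union_comp : ∀ s, ∀ x ∈ terr s, ∀ y, Reaches G (guard s) x y → Reaches G (guard s) y x →
    y ∈ terr s
  start : ∀ w, ∃ s, guard s = ∅ ∧ w ∈ terr s
  step : ∀ s, ∀ w ∈ terr s, w ≠ next s → ∃ s', guard s' ⊆ insert (next s) (guard s) ∧
    zone s' ⊆ zone s \ {next s} ∧ w ∈ terr s'

theorem CompCertificate.copsWin [Finite V] {G : Digraph V} {k : ℕ} (c : CompCertificate G k) :
    CopsWinDirectedTreeWidthGame G k := by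
  have sub : ∀ s C R, guard c s ⊆ C → IsComponent G C R →
      ∀ w ∈ R, w ∈ c.terr s → R ⊆ c.terr s := by
    intro s C R hg hR w hw hwz x hx
    exact c.union_comp s w hwz x ((hR.reaches hw hx).anti hg) ((hR.reaches hx hw).anti hg)
  refine hasMonotoneWinningStrategy_of_states (fun _ _ _ _ h => h.1) c.guard c.zone c.terr c.next
    c.card_le c.next_mem ?_ ?_
  · intro R hR
    obtain ⟨w, hw⟩ := hR.nonempty
    obtain ⟨s, hs, hws⟩ := c.start w
    exact ⟨s, hs, sub s ∅ R hs.le hR w hw hws⟩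
  · rintro s C R R' hg hd hR hRz ⟨hR', K, hK, hRK, hR'K⟩
    have hgC : c.guard s ⊆ C ∩ insert (c.next s) (c.guard s) :=
      Set.subset_inter hg (Set.subset_insert _ _)
    obtain ⟨u, hu⟩ := hR.nonempty
    have hKt : K ⊆ c.terr s := sub s _ K hgC hK u (hRK hu) (hRz hu)
    have hCK : C ⊆ Kᶜ := fun x hx hxK =>
      Set.disjoint_left.1 hd hx (c.terr_subset s (hKt hxK))
    obtain ⟨w, hw⟩ := hR'.nonempty
    refine ⟨fun x hx => ?_, ?_⟩
    · exact hR.mem hu ((hK.reaches_compl (hRK hu) (hR'K hx)).anti hCK)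
        ((hK.reaches_compl (hR'K hx) (hRK hu)).anti hCK)
    · have hne : w ≠ c.next s := fun h => (hR'.reaches hw hw).1 (h ▸ Set.mem_insert _ _)
      obtain ⟨s', h1, h2, h3⟩ := c.step s w (hKt (hR'K hw)) hne
      exact ⟨s', h1, h2, sub s' _ R' h1 hR' w hw h3⟩

/-- A subset of a set that is left only through `X` is a union of components of `G - X` if it is not
entered from the rest of that set. -/
theorem mem_of_reaches_of_closed {G : Digraph V} {X Z T : Set V}
    (hZ : ∀ a ∈ Z, ∀ b, G.Adj a b → b ∈ Z ∪ X) (hTZ : T ⊆ Z)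
    (hT : ∀ a ∈ Z, a ∉ T → ∀ b, G.Adj a b → b ∉ T) {x y : V} (hx : x ∈ T)
    (hxy : Reaches G X x y) (hyx : Reaches G X y x) : y ∈ T := by
  by_contra hy
  have hyZ := hxy.mem_of_closed hZ (hTZ hx)
  have : x ∈ Z \ T := by
    refine hyx.mem_of_closed (Z := Z \ T) ?_ ⟨hyZ, hy⟩
    rintro a ⟨ha, haT⟩ b hab
    rcases hZ a ha b hab with h | h
    · exact .inl ⟨h, hT a ha haT b hab⟩
    · exact .inr h
  exact this.2 hx

/-! ### Disjoint unions -/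

/-- The disjoint union of two digraphs. -/
def disjSum {W : Type} (G : Digraph V) (H : Digraph W) : Digraph (V ⊕ W) where
  Adj := Sum.LiftRel G.Adj H.Adj

section DisjSum

variable {W : Type} {G : Digraph V} {H : Digraph W}

@[simp] theorem disjSum_adj_inl {a b : V} :
    (disjSum G H).Adj (.inl a) (.inl b) ↔ G.Adj a b := Sum.liftRel_inl_inl

@[simp] theorem disjSum_adj_inr {a b : W} :
    (disjSum G H).Adj (.inr a) (.inr b) ↔ H.Adj a b := Sum.liftRel_inr_inr

theorem closed_inl {Z N : Set V} (h : ∀ a ∈ Z, ∀ b, G.Adj a b → b ∈ Z ∪ N) :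
    ∀ a ∈ Sum.inl '' Z, ∀ b, (disjSum G H).Adj a b → b ∈ Sum.inl '' Z ∪ Sum.inl '' N := by
  rintro _ ⟨a, ha, rfl⟩ _ ⟨hab⟩
  rw [← Set.image_union]
  exact Set.mem_image_of_mem _ (h a ha _ hab)

theorem closed_inr {Z N : Set W} (h : ∀ a ∈ Z, ∀ b, H.Adj a b → b ∈ Z ∪ N) :
    ∀ a ∈ Sum.inr '' Z, ∀ b, (disjSum G H).Adj a b → b ∈ Sum.inr '' Z ∪ Sum.inr '' N := by
  rintro _ ⟨a, ha, rfl⟩ _ hab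
  cases hab with
  | inr hab =>
    rw [← Set.image_union]
    exact Set.mem_image_of_mem _ (h a ha _ hab)

theorem reaches_inl {N : Set V} {x : V} {y : V ⊕ W}
    (h : Reaches (disjSum G H) (Sum.inl '' N) (.inl x) y) : ∃ z, y = .inl z ∧ Reaches G N x z := by
  obtain ⟨h1, h2⟩ := h
  induction h2 with
  | refl => exact ⟨x, rfl, fun hx => h1 ⟨x, hx, rfl⟩, .refl⟩
  | tail _ hab ih =>
    obtain ⟨z, rfl, hz⟩ := ih
    obtain ⟨hab, hb⟩ := hab
    cases hab with
    | inl hab => exact ⟨_, rfl, hz.1, hz.2.tail ⟨hab, fun hc => hb ⟨_, hc, rfl⟩⟩⟩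

theorem reaches_inr {N : Set W} {x : W} {y : V ⊕ W}
    (h : Reaches (disjSum G H) (Sum.inr '' N) (.inr x) y) : ∃ z, y = .inr z ∧ Reaches H N x z := by
  obtain ⟨h1, h2⟩ := h
  induction h2 with
  | refl => exact ⟨x, rfl, fun hx => h1 ⟨x, hx, rfl⟩, .refl⟩
  | tail _ hab ih =>
    obtain ⟨z, rfl, hz⟩ := ih
    obtain ⟨hab, hb⟩ := hab
    cases hab with
    | inr hab => exact ⟨_, rfl, hz.1, hz.2.tail ⟨hab, fun hc => hb ⟨_, hc, rfl⟩⟩⟩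

theorem step_image {α β : Type} {f : α → β} (hf : f.Injective) {N N' Z Z' : Set α} {x : α}
    (h1 : N' ⊆ insert x N) (h2 : Z' ⊆ Z \ {x}) :
    f '' N' ⊆ insert (f x) (f '' N) ∧ f '' Z' ⊆ f '' Z \ {f x} := by
  rw [← Set.image_insert_eq, ← Set.image_singleton, ← Set.image_sdiff hf]
  exact ⟨Set.image_mono h1, Set.image_mono h2⟩

theorem ncard_insert_image {α β : Type} {f : α → β} (hf : f.Injective) {N : Set α} {x : α} {k : ℕ}
    (h : (insert x N).ncard ≤ k) : (insert (f x) (f '' N)).ncard ≤ k := by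
  rwa [← Set.image_insert_eq, Set.ncard_image_of_injective _ hf]

/-- The robber chooses one side of a disjoint union and stays there, so that certificates for the
two sides combine. -/
def ReachCertificate.sum {k : ℕ} (c : ReachCertificate G k) (d : ReachCertificate H k) :
    ReachCertificate (disjSum G H) k where
  State := c.State ⊕ d.State
  guard := Sum.elim (fun s => Sum.inl '' c.guard s) (fun s => Sum.inr '' d.guard s)
  zone := Sum.elim (fun s => Sum.inl '' c.zone s) (fun s => Sum.inr '' d.zone s)
  next := Sum.map c.next d.next
  card_le := by
    rintro (s | s)
    · exact ncard_insert_image Sum.inl_injective (c.card_le s)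
    · exact ncard_insert_image Sum.inr_injective (d.card_le s)
  next_mem := by
    rintro (s | s)
    · exact ⟨_, c.next_mem s, rfl⟩
    · exact ⟨_, d.next_mem s, rfl⟩
  closed := by
    rintro (s | s)
    · exact closed_inl (c.closed s)
    · exact closed_inr (d.closed s)
  start := by
    rintro (w | w)
    · obtain ⟨s, h1, h2⟩ := c.start w
      exact ⟨.inl s, by simp [h1], by simpa using h2⟩
    · obtain ⟨s, h1, h2⟩ := d.start w
      exact ⟨.inr s, by simp [h1], by simpa using h2⟩
  step := by
    rintro (s | s)
    · rintro _ ⟨w, hw, rfl⟩ hne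
      obtain ⟨s', h1, h2, h3⟩ := c.step s w hw fun h => hne (congrArg _ h)
      exact ⟨.inl s', (step_image Sum.inl_injective h1 h2).1,
        (step_image Sum.inl_injective h1 h2).2, ⟨w, h3, rfl⟩⟩
    · rintro _ ⟨w, hw, rfl⟩ hne
      obtain ⟨s', h1, h2, h3⟩ := d.step s w hw fun h => hne (congrArg _ h)
      exact ⟨.inr s', (step_image Sum.inr_injective h1 h2).1,
        (step_image Sum.inr_injective h1 h2).2, ⟨w, h3, rfl⟩⟩

/-- The combination of certificates for the two sides of a disjoint union. -/
def CompCertificate.sum {k : ℕ} (c : CompCertificate G k) (d : CompCertificate H k) :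
    CompCertificate (disjSum G H) k where
  State := c.State ⊕ d.State
  guard := Sum.elim (fun s => Sum.inl '' c.guard s) (fun s => Sum.inr '' d.guard s)
  zone := Sum.elim (fun s => Sum.inl '' c.zone s) (fun s => Sum.inr '' d.zone s)
  terr := Sum.elim (fun s => Sum.inl '' c.terr s) (fun s => Sum.inr '' d.terr s)
  next := Sum.map c.next d.next
  card_le := by
    rintro (s | s)
    · exact ncard_insert_image Sum.inl_injective (c.card_le s)
    · exact ncard_insert_image Sum.inr_injective (d.card_le s)
  next_mem := by
    rintro (s | s)
    · exact ⟨_, c.next_mem s, rfl⟩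
    · exact ⟨_, d.next_mem s, rfl⟩
  terr_subset := by
    rintro (s | s)
    · exact Set.image_mono (c.terr_subset s)
    · exact Set.image_mono (d.terr_subset s)
  union_comp := by
    rintro (s | s)
    · rintro _ ⟨x, hx, rfl⟩ y hxy hyx
      obtain ⟨y, rfl, hy⟩ := reaches_inl hxy
      obtain ⟨z, hz, hz'⟩ := reaches_inl hyx
      obtain rfl := Sum.inl_injective hz
      exact ⟨y, c.union_comp s x hx y hy hz', rfl⟩
    · rintro _ ⟨x, hx, rfl⟩ y hxy hyx
      obtain ⟨y, rfl, hy⟩ := reaches_inr hxy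
      obtain ⟨z, hz, hz'⟩ := reaches_inr hyx
      obtain rfl := Sum.inr_injective hz
      exact ⟨y, d.union_comp s x hx y hy hz', rfl⟩
  start := by
    rintro (w | w)
    · obtain ⟨s, h1, h2⟩ := c.start w
      exact ⟨.inl s, by simp [h1], by simpa using h2⟩
    · obtain ⟨s, h1, h2⟩ := d.start w
      exact ⟨.inr s, by simp [h1], by simpa using h2⟩
  step := by
    rintro (s | s)
    · rintro _ ⟨w, hw, rfl⟩ hne
      obtain ⟨s', h1, h2, h3⟩ := c.step s w hw fun h => hne (congrArg _ h)
      exact ⟨.inl s', (step_image Sum.inl_injective h1 h2).1,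
        (step_image Sum.inl_injective h1 h2).2, ⟨w, h3, rfl⟩⟩
    · rintro _ ⟨w, hw, rfl⟩ hne
      obtain ⟨s', h1, h2, h3⟩ := d.step s w hw fun h => hne (congrArg _ h)
      exact ⟨.inr s', (step_image Sum.inr_injective h1 h2).1,
        (step_image Sum.inr_injective h1 h2).2, ⟨w, h3, rfl⟩⟩

end DisjSum

/-! ### Kelly-width -/

/-- A state of a reachability certificate whose zone lies below the vertex `v` that is occupied next
bounds the support of `v`, because the guard separates the zone from the rest of the graph. -/
theorem exists_eliminationWidth_le [Fintype V] {G : Digraph V} {k : ℕ} (r : V → ℕ)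
    (h : ∀ v, ∃ Z N : Set V, v ∈ Z ∧ (∀ a ∈ Z, ∀ b, G.Adj a b → b ∈ Z ∪ N) ∧ N.ncard ≤ k ∧
      (∀ z ∈ Z, z = v ∨ r v < r z) ∧ ∀ u ∈ N, r u < r v) :
    ∃ L : LinearOrder V, eliminationWidth G L ≤ k := by
  let f : V → ℕᵒᵈ ×ₗ Fin (Fintype.card V) := fun v =>
    toLex (OrderDual.toDual (r v), Fintype.equivFin V v)
  have hf : f.Injective := fun a b hab => by
    have : Fintype.equivFin V a = Fintype.equivFin V b := congrArg (fun x => (ofLex x).2) hab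
    exact (Fintype.equivFin V).injective this
  refine ⟨LinearOrder.lift' f hf, Finset.sup_le fun v _ => ?_⟩
  have hlt : ∀ a b, (LinearOrder.lift' f hf).lt a b ↔ f a < f b := fun a b => Iff.rfl
  have below : ∀ z, (z = v ∨ r v < r z) → ¬ f v < f z := by
    rintro z (rfl | hz) hvz
    · exact lt_irrefl _ hvz
    · exact lt_asymm hvz (Prod.Lex.toLex_lt_toLex.2 (.inl (OrderDual.toDual_lt_toDual.2 hz)))
  obtain ⟨Z, N, hv, hcl, hN, hZ, hNv⟩ := h v
  refine (Set.ncard_le_ncard ?_ (Set.toFinite N)).trans hN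
  rintro u ⟨hvu, v', hv', hadj⟩
  have hZ' : v' ∈ Z := by
    refine Reaches.mem_of_closed hv' (fun a ha b hab => ?_) hv
    refine (hcl a ha b hab).imp_right fun hb => (hlt _ _).2 ?_
    exact Prod.Lex.toLex_lt_toLex.2 (.inl (OrderDual.toDual_lt_toDual.2 (hNv b hb)))
  exact (hcl v' hZ' u hadj).resolve_left fun hu => below u (hZ u hu) ((hlt _ _).1 hvu)

/-- The least vertex of an induced subgraph sees all its out-neighbours in that subgraph. -/
theorem le_eliminationWidth_of_outdegree [Fintype V] {W : Type} [Fintype W] [Nonempty W]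
    {G : Digraph V} {k : ℕ} (f : W → V) (hf : f.Injective)
    (h : ∀ w, ∃ t : Finset W, k ≤ t.card ∧ w ∉ t ∧ ∀ x ∈ t, G.Adj (f w) (f x))
    (L : LinearOrder V) : k ≤ eliminationWidth G L := by
  obtain ⟨w, -, hw⟩ := Finset.exists_min_image (Finset.univ : Finset W) f Finset.univ_nonempty
  obtain ⟨t, ht, hwt, hadj⟩ := h w
  have h1 : f '' (t : Set W) ⊆ support G L (f w) := by
    rintro _ ⟨x, hx, rfl⟩
    refine ⟨lt_of_le_of_ne (hw x (Finset.mem_univ _)) fun he => ?_, f w,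
      Reaches.refl fun hlt => lt_irrefl _ hlt, hadj x hx⟩
    exact hwt (hf he ▸ hx)
  calc k ≤ (f '' (t : Set W)).ncard := by
        rwa [Set.ncard_image_of_injective _ hf, Set.ncard_coe_finset]
    _ ≤ (support G L (f w)).ncard := Set.ncard_le_ncard h1 (Set.toFinite _)
    _ ≤ eliminationWidth G L :=
        Finset.le_sup (f := fun v => (support G L v).ncard) (Finset.mem_univ (f w))

theorem kellyWidth_eq [Fintype V] {G : Digraph V} {k : ℕ}
    (h1 : ∃ L : LinearOrder V, eliminationWidth G L ≤ k)
    (h2 : ∀ L : LinearOrder V, k ≤ eliminationWidth G L) : kellyWidth G = 1 + k := by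
  obtain ⟨L, hL⟩ := h1
  have hk : k ∈ {w | ∃ L : LinearOrder V, eliminationWidth G L = w} :=
    ⟨L, le_antisymm hL (h2 L)⟩
  obtain ⟨L', hL'⟩ := Nat.sInf_mem ⟨k, hk⟩
  rw [kellyWidth, le_antisymm (Nat.sInf_le hk) (hL' ▸ h2 L')]

/-! ### A digraph on five vertices of Kelly-width four -/

/-- The digraph that arises from the complete digraph on `0, 1, 2, 3` by deletion of the edge
`(3, 0)` and addition of a vertex `4` with edges `(4, 1)`, `(4, 2)`, `(4, 3)` and `(3, 4)`. -/
def smallDigraph : Digraph (Fin 5) where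
  Adj a b := a ≠ b ∧ (b = 0 → a ≠ 3 ∧ a ≠ 4) ∧ (b = 4 → a = 3)

theorem smallDigraph_outdegree (w : Fin 5) :
    ∃ t : Finset (Fin 5), 3 ≤ t.card ∧ w ∉ t ∧ ∀ x ∈ t, smallDigraph.Adj w x := by
  have key : ∀ w : Fin 5, ∃ t : Finset (Fin 5), 3 ≤ t.card ∧ w ∉ t ∧
      ∀ x ∈ t, w ≠ x ∧ (x = 0 → w ≠ 3 ∧ w ≠ 4) ∧ (x = 4 → w = 3) := by decide
  exact key w

/-- The vertices that remain occupied in the reachability game when the robber is in the set of the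
vertices that are at least `i`: all smaller ones, except for the vertex `0` if `i = 4`. -/
def smallGuard (i : Fin 5) : Finset (Fin 5) := {j | j < i ∧ (i = 4 → j ≠ 0)}

/-- Four cops occupy the vertices in their order; the vertex `0` becomes dispensable when only the
vertex `4` is left to the robber. -/
def smallReachCertificate : ReachCertificate smallDigraph 4 where
  State := Fin 5
  guard i := smallGuard i
  zone i := {j | i ≤ j}
  next i := i
  card_le i := by
    rw [← Finset.coe_insert, Set.ncard_coe_finset]
    revert i
    decide
  next_mem i := le_refl i
  closed := by
    have key : ∀ i a : Fin 5, i ≤ a → ∀ b : Fin 5,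
        (a ≠ b ∧ (b = 0 → a ≠ 3 ∧ a ≠ 4) ∧ (b = 4 → a = 3)) → i ≤ b ∨ b ∈ smallGuard i := by
      decide
    exact key
  start w := ⟨0, by simp [smallGuard], Fin.zero_le w⟩
  step := by
    have key : ∀ i w : Fin 5, i ≤ w → w ≠ i → ∃ i', smallGuard i' ⊆ insert i (smallGuard i) ∧
        (∀ j, i' ≤ j → i ≤ j ∧ j ≠ i) ∧ i' ≤ w := by
      decide
    intro i w hw hne
    obtain ⟨i', h1, h2, h3⟩ := key i w hw hne
    exact ⟨i', by exact_mod_cast h1, h2, h3⟩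

/-- The vertices that remain occupied in the component game when the robber is in the set of the
vertices that are at least `i`. -/
def smallCompGuard (i : Fin 5) : Finset (Fin 5) :=
  {j | j < i ∧ (i = 3 → j ≠ 0) ∧ (i = 4 → j = 3)}

/-- In the component game three cops suffice: in front of the robber component `{3, 4}` the vertex
`0` is dispensable, and `{4}` is a component after deletion of the vertex `3` alone, through which
every path to `4` leads. -/
def smallCompCertificate : CompCertificate smallDigraph 3 where
  State := Fin 5
  guard i := smallCompGuard i
  zone i := {j | i ≤ j}
  terr i := {j | i ≤ j}
  next i := i
  card_le i := by
    rw [← Finset.coe_insert, Set.ncard_coe_finset]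
    revert i
    decide
  next_mem i := le_refl i
  terr_subset _ := subset_rfl
  union_comp := by
    intro i x hx y hxy hyx
    have key : ∀ i a : Fin 5, (if i = 4 then a ≠ 3 else i ≤ a) → ∀ b : Fin 5,
        (a ≠ b ∧ (b = 0 → a ≠ 3 ∧ a ≠ 4) ∧ (b = 4 → a = 3)) →
        (if i = 4 then b ≠ 3 else i ≤ b) ∨ b ∈ smallCompGuard i := by
      decide
    have key' : ∀ i a : Fin 5, (if i = 4 then a ≠ 3 else i ≤ a) → ¬ i ≤ a → ∀ b : Fin 5,
        (a ≠ b ∧ (b = 0 → a ≠ 3 ∧ a ≠ 4) ∧ (b = 4 → a = 3)) → ¬ i ≤ b := by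
      decide
    have key'' : ∀ i a : Fin 5, i ≤ a → if i = 4 then a ≠ 3 else i ≤ a := by decide
    exact mem_of_reaches_of_closed (G := smallDigraph) (X := smallCompGuard i)
      (Z := {a | if i = 4 then a ≠ 3 else i ≤ a}) (T := {a | i ≤ a})
      (key i) (key'' i) (key' i) hx hxy hyx
  start w := ⟨0, by simp [smallCompGuard], Fin.zero_le w⟩
  step := by
    have key : ∀ i w : Fin 5, i ≤ w → w ≠ i →
        ∃ i', smallCompGuard i' ⊆ insert i (smallCompGuard i) ∧
        (∀ j, i' ≤ j → i ≤ j ∧ j ≠ i) ∧ i' ≤ w := by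
      decide
    intro i w hw hne
    obtain ⟨i', h1, h2, h3⟩ := key i w hw hne
    exact ⟨i', by exact_mod_cast h1, h2, h3⟩

/-! ### The nested digraph -/

/-- A vertex of the nested digraph: the vertex `(u, k)` is the `k`-th vertex of the path of the
region `u`. The region `(i, j) :: u` is a subregion of the region `u`. -/
abbrev NestedVertex := List (ℕ × ℕ) × ℕ

/-- Adjacency in the nested digraph. The edges are those of the bidirected paths, the edges from the
`i`-th vertex of the path of `u` to everything inside its subregions `(i, j) :: u`, the edges back
from the first vertex of the path of such a subregion to the `i`-th vertex, and the edges from the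
whole path of the subregion to the `j`-th vertex. -/
inductive NestedAdj : NestedVertex → NestedVertex → Prop
  | up (u : List (ℕ × ℕ)) (k : ℕ) : NestedAdj (u, k) (u, k + 1)
  | down (u : List (ℕ × ℕ)) (k : ℕ) : NestedAdj (u, k + 1) (u, k)
  | enter {u w : List (ℕ × ℕ)} {i j : ℕ} (l : ℕ) (h : (i, j) :: u <:+ w) :
      NestedAdj (u, i) (w, l)
  | back (u : List (ℕ × ℕ)) {i j : ℕ} (h : i < j) : NestedAdj ((i, j) :: u, 0) (u, i)
  | leave (u : List (ℕ × ℕ)) {i j : ℕ} (l : ℕ) (h : i < j) : NestedAdj ((i, j) :: u, l) (u, j)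

/-- The region of `u`: all vertices of the path of `u` and of all nested subregions. -/
def region (u : List (ℕ × ℕ)) : Set NestedVertex := {x | u <:+ x.1}

/-- The part of the region of `u` that remains when the first `k` vertices of its path and the
subregions attached to them are removed. -/
def tailRegion (u : List (ℕ × ℕ)) (k : ℕ) : Set NestedVertex :=
  {x | (x.1 = u ∧ k ≤ x.2) ∨ ∃ i j, k ≤ i ∧ (i, j) :: u <:+ x.1}

/-- The vertex through which the region of `u` is left other than backwards; it exists unless `u` is
the outermost region. -/
def exitSet : List (ℕ × ℕ) → Finset NestedVertex
  | [] => ∅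
  | (_, j) :: u => {(u, j)}

/-- The vertex to which the `k`-th vertex of the path of `u` leads back. -/
def prevSet : List (ℕ × ℕ) → ℕ → Finset NestedVertex
  | u, k + 1 => {(u, k)}
  | [], 0 => ∅
  | (i, _) :: u, 0 => {(u, i)}

theorem tailRegion_zero (u : List (ℕ × ℕ)) : tailRegion u 0 = region u := by
  ext ⟨w, l⟩
  simp only [tailRegion, region, Set.mem_ofPred_eq, Nat.zero_le, and_true, true_and]
  constructor
  · rintro (rfl | ⟨i, j, h⟩)
    · exact List.suffix_rfl
    · exact (List.suffix_cons _ _).trans h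
  · rintro ⟨t, rfl⟩
    rcases t.eq_nil_or_concat' with rfl | ⟨t', ⟨i, j⟩, rfl⟩
    · exact .inl rfl
    · exact .inr ⟨i, j, t', by simp⟩

theorem tailRegion_subset_region (u : List (ℕ × ℕ)) (k : ℕ) : tailRegion u k ⊆ region u := by
  rw [← tailRegion_zero]
  rintro x (⟨h, -⟩ | ⟨i, j, -, h⟩)
  · exact .inl ⟨h, Nat.zero_le _⟩
  · exact .inr ⟨i, j, Nat.zero_le _, h⟩

theorem tailRegion_anti (u : List (ℕ × ℕ)) {k l : ℕ} (h : k ≤ l) :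
    tailRegion u l ⊆ tailRegion u k := by
  rintro x (⟨h1, h2⟩ | ⟨i, j, h1, h2⟩)
  · exact .inl ⟨h1, h.trans h2⟩
  · exact .inr ⟨i, j, h.trans h1, h2⟩

theorem region_cons_subset_tailRegion (u : List (ℕ × ℕ)) {i j k : ℕ} (h : k ≤ i) :
    region ((i, j) :: u) ⊆ tailRegion u k := fun _ hx => .inr ⟨i, j, h, hx⟩

/-- Removing the `k`-th vertex of the path of `u` splits the tail into the next tail and the
subregions attached to that vertex. -/
theorem mem_tailRegion_cases {u : List (ℕ × ℕ)} {k : ℕ} {x : NestedVertex}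
    (h : x ∈ tailRegion u k) (hne : x ≠ (u, k)) :
    x ∈ tailRegion u (k + 1) ∨ ∃ j, x ∈ region ((k, j) :: u) := by
  rcases h with ⟨rfl, h⟩ | ⟨i, j, h, hs⟩
  · refine .inl (.inl ⟨rfl, lt_of_le_of_ne h ?_⟩)
    rintro rfl
    exact hne rfl
  · rcases h.eq_or_lt with rfl | h
    · exact .inr ⟨j, hs⟩
    · exact .inl (.inr ⟨i, j, h, hs⟩)

theorem not_cons_suffix {p : ℕ × ℕ} {u : List (ℕ × ℕ)} : ¬ p :: u <:+ u := fun h => by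
  have := h.length_le
  simp at this

theorem notMem_tailRegion_succ (u : List (ℕ × ℕ)) (k : ℕ) : (u, k) ∉ tailRegion u (k + 1) := by
  rintro (⟨-, h⟩ | ⟨i, j, -, h⟩)
  · exact absurd h (Nat.not_succ_le_self k)
  · exact not_cons_suffix h

theorem notMem_region_cons (u : List (ℕ × ℕ)) (p : ℕ × ℕ) (k : ℕ) : (u, k) ∉ region (p :: u) :=
  not_cons_suffix

/-- A subregion is left only to the two vertices of the surrounding path it is attached to. -/
theorem region_cons_closed {u : List (ℕ × ℕ)} {i j : ℕ} {a b : NestedVertex}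
    (ha : a ∈ region ((i, j) :: u)) (hab : NestedAdj a b) :
    b ∈ region ((i, j) :: u) ∨ b = (u, i) ∨ (i < j ∧ b = (u, j)) := by
  cases hab with
  | up w k => exact .inl ha
  | down w k => exact .inl ha
  | enter l h => exact .inl (List.IsSuffix.trans ha ((List.suffix_cons _ _).trans h))
  | back w h =>
    rcases List.suffix_cons_iff.1 ha with h1 | h1
    · obtain ⟨h2, rfl⟩ := List.cons.inj h1
      obtain ⟨rfl, rfl⟩ := Prod.mk.inj h2
      exact .inr (.inl rfl)
    · exact .inl h1
  | leave w l h =>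
    rcases List.suffix_cons_iff.1 ha with h1 | h1
    · obtain ⟨h2, rfl⟩ := List.cons.inj h1
      obtain ⟨rfl, rfl⟩ := Prod.mk.inj h2
      exact .inr (.inr ⟨h, rfl⟩)
    · exact .inl h1

theorem tailRegion_closed {u : List (ℕ × ℕ)} {k : ℕ} {a b : NestedVertex}
    (ha : a ∈ tailRegion u k) (hab : NestedAdj a b) :
    b ∈ tailRegion u k ∨ b ∈ exitSet u ∪ prevSet u k := by
  rcases ha with ⟨ha, hk⟩ | ⟨i, j, hk, ha⟩
  · cases hab with
    | up w l => exact .inl (.inl ⟨ha, by simp at hk ⊢; omega⟩)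
    | down w l =>
      obtain rfl : w = u := ha
      rcases (show k ≤ l + 1 from hk).eq_or_lt with rfl | h
      · right
        simp [prevSet]
      · exact .inl (.inl ⟨rfl, Nat.lt_succ_iff.1 h⟩)
    | enter l h =>
      obtain rfl := ha
      exact .inl (.inr ⟨_, _, hk, h⟩)
    | back w h =>
      obtain rfl := ha
      obtain rfl : k = 0 := Nat.le_zero.1 hk
      right
      simp [prevSet]
    | leave w l h =>
      obtain rfl := ha
      right
      simp [exitSet]
  · rcases region_cons_closed ha hab with h | rfl | ⟨h, rfl⟩
    · exact .inl (.inr ⟨i, j, hk, h⟩)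
    · exact .inl (.inl ⟨rfl, hk⟩)
    · exact .inl (.inl ⟨rfl, hk.trans h.le⟩)

/-- A subregion attached to the `i`-th vertex of a path is not entered from the tail that follows
that vertex. -/
theorem tailRegion_not_adj_region {u : List (ℕ × ℕ)} {i j : ℕ} {a b : NestedVertex}
    (ha : a ∈ tailRegion u (i + 1)) (ha' : a ∉ region ((i, j) :: u)) (hab : NestedAdj a b) :
    b ∉ region ((i, j) :: u) := by
  intro hb
  cases hab with
  | up w k => exact ha' hb
  | down w k => exact ha' hb
  | back w h => exact ha' (List.IsSuffix.trans hb (List.suffix_cons _ _))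
  | leave w l h => exact ha' (List.IsSuffix.trans hb (List.suffix_cons _ _))
  | @enter v w i' j' l h =>
    have hu : u <:+ v := tailRegion_subset_region _ _ ha
    -- The two subregions that contain `b` are nested.
    rcases List.suffix_or_suffix_of_suffix h hb with h1 | h1
    · rcases List.suffix_cons_iff.1 h1 with h2 | h2
      · obtain ⟨h3, rfl⟩ := List.cons.inj h2
        obtain ⟨rfl, rfl⟩ := Prod.mk.inj h3
        exact notMem_tailRegion_succ _ _ ha
      · exact not_cons_suffix (h2.trans hu)
    · rcases List.suffix_cons_iff.1 h1 with h2 | h2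
      · obtain ⟨h3, rfl⟩ := List.cons.inj h2
        obtain ⟨rfl, rfl⟩ := Prod.mk.inj h3
        exact notMem_tailRegion_succ _ _ ha
      · exact ha' h2

theorem card_exitSet_le (u : List (ℕ × ℕ)) : (exitSet u).card ≤ 1 := by
  rcases u with _ | ⟨⟨i, j⟩, u⟩ <;> simp [exitSet]

theorem card_prevSet_le (u : List (ℕ × ℕ)) (k : ℕ) : (prevSet u k).card ≤ 1 := by
  rcases u with _ | ⟨⟨i, j⟩, u⟩ <;> rcases k with _ | k <;> simp [prevSet]

/-- The finite vertex set of the nested digraph with parameter `n`: the nesting depth is at most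
`n`, the paths have `n` vertices. -/
def NestedValid (n : ℕ) (x : NestedVertex) : Prop :=
  x.1.length ≤ n ∧ (∀ p ∈ x.1, p.1 < p.2 ∧ p.2 < n) ∧ x.2 < n

theorem finite_nestedValid (n : ℕ) : {x | NestedValid n x}.Finite := by
  have h : ∀ d, {u : List (ℕ × ℕ) | u.length ≤ d ∧ ∀ p ∈ u, p.1 < p.2 ∧ p.2 < n}.Finite := by
    intro d
    induction d with
    | zero =>
      refine (Set.finite_singleton []).subset ?_
      rintro u ⟨h, -⟩
      exact List.length_eq_zero_iff.1 (Nat.le_zero.1 h)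
    | succ d ih =>
      refine ((Set.finite_singleton []).union (Set.Finite.image2 List.cons
        ((Set.finite_Iio n).prod (Set.finite_Iio n)) ih)).subset ?_
      rintro (_ | ⟨p, u⟩) ⟨h1, h2⟩
      · exact .inl rfl
      · have hp := h2 p (by simp)
        exact .inr ⟨p, ⟨hp.1.trans hp.2, hp.2⟩, u, ⟨by simpa using h1,
          fun q hq => h2 q (by simp [hq])⟩, rfl⟩
  refine ((h n).prod (Set.finite_Iio n)).subset ?_
  rintro x ⟨h1, h2, h3⟩
  exact ⟨⟨h1, h2⟩, h3⟩

/-- The vertex type of the nested digraph with parameter `n`. -/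
abbrev NestedType (n : ℕ) := {x : NestedVertex // NestedValid n x}

instance (n : ℕ) : Finite (NestedType n) := (finite_nestedValid n).to_subtype

/-- The nested digraph with parameter `n`. -/
def nestedDigraph (n : ℕ) : Digraph (NestedType n) where
  Adj a b := NestedAdj a.1 b.1

theorem not_nestedAdj_self (x : NestedVertex) : ¬ NestedAdj x x := by
  generalize hy : x = y
  nth_rw 1 [← hy]
  intro h
  cases h with
  | up u k => simp at hy
  | down u k => simp at hy
  | enter l h =>
    obtain ⟨rfl, -⟩ := Prod.mk.inj hy
    exact not_cons_suffix h
  | back u h => simp at hy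
  | leave u l h => simp at hy

section Certificates

/-- The trace of a set of vertices on the nested digraph with parameter `n`. -/
def trace (n : ℕ) (s : Set NestedVertex) : Set (NestedType n) := Subtype.val ⁻¹' s

variable {n : ℕ}

theorem ncard_insert_trace_le {k : ℕ} (x : NestedType n) (s : Finset NestedVertex)
    (h : s.card ≤ k) : (insert x (trace n s)).ncard ≤ k + 1 := by
  refine (Set.ncard_insert_le _ _).trans (Nat.add_le_add_right ?_ 1)
  rw [← Set.ncard_image_of_injective _ Subtype.val_injective]
  refine (Set.ncard_le_ncard (Set.image_preimage_subset _ _) s.finite_toSet).trans ?_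
  rwa [Set.ncard_coe_finset]

theorem trace_subset_insert {x : NestedType n} {s t : Set NestedVertex}
    (h : ∀ y ∈ s, y = x.1 ∨ y ∈ t) : trace n s ⊆ insert x (trace n t) := fun y hy =>
  (h y.1 hy).imp_left fun e => Subtype.ext e

theorem trace_subset_diff {x : NestedType n} {s t : Set NestedVertex}
    (h : s ⊆ t) (hx : x.1 ∉ s) : trace n s ⊆ trace n t \ {x} := fun y hy =>
  ⟨h hy, fun e => hx (by rw [Set.mem_singleton_iff] at e; exact e ▸ hy)⟩

end Certificates

/-! ### Strategies and elimination order on the nested digraph -/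

section NestedStrategies

variable {n : ℕ}

theorem NestedValid.of_suffix {x : NestedVertex} (hx : NestedValid n x) {u : List (ℕ × ℕ)}
    (hu : u <:+ x.1) {k : ℕ} (hk : k < n) : NestedValid n (u, k) :=
  ⟨hu.length_le.trans hx.1, fun p hp => hx.2.1 p (hu.subset hp), hk⟩

theorem NestedValid.of_cons_suffix {x : NestedVertex} (hx : NestedValid n x) {i j : ℕ}
    {u : List (ℕ × ℕ)} (hu : (i, j) :: u <:+ x.1) : i < j ∧ j < n :=
  hx.2.1 (i, j) (hu.subset List.mem_cons_self)

theorem NestedValid.lt_of_mem_tailRegion {x : NestedVertex} (hx : NestedValid n x)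
    {u : List (ℕ × ℕ)} {k : ℕ} (h : x ∈ tailRegion u k) : k < n := by
  rcases h with ⟨-, h⟩ | ⟨i, j, h, hs⟩
  · exact h.trans_lt hx.2.2
  · have := hx.of_cons_suffix hs
    omega

theorem trace_closed {s t : Set NestedVertex}
    (h : ∀ a ∈ s, ∀ b, NestedAdj a b → b ∈ s ∨ b ∈ t) :
    ∀ a ∈ trace n s, ∀ b, (nestedDigraph n).Adj a b → b ∈ trace n s ∪ trace n t :=
  fun a ha b hab => h a.1 ha b.1 hab

/-- The states of the cops in the component game on the nested digraph. In the state `tail u k`, the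
robber is in what remains of the region of `u` after the removal of the first `k` vertices of its
path. In the state `cross u i j`, he has just entered the subregion `(i, j) :: u`, while the cops
still have to occupy its exit `(u, j)`. -/
inductive CompState (n : ℕ)
  | tail (u : List (ℕ × ℕ)) (k : ℕ) (h : NestedValid n (u, k))
  | cross (u : List (ℕ × ℕ)) (i j : ℕ) (hij : i < j) (h : NestedValid n (u, j))

namespace CompState

/-- The vertices that the cops keep occupied. -/
def guard : CompState n → Finset NestedVertex
  | tail u k _ => exitSet u ∪ prevSet u k
  | cross u i _ _ _ => exitSet u ∪ {(u, i)}

/-- The vertices that are available to the robber. -/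
def terr : CompState n → Set NestedVertex
  | tail u k _ => tailRegion u k
  | cross u i j _ _ => region ((i, j) :: u)

/-- The vertices that are available to the robber or still to be occupied. -/
def zone : CompState n → Set NestedVertex
  | tail u k _ => tailRegion u k
  | cross u i j _ _ => region ((i, j) :: u) ∪ tailRegion u (i + 1)

/-- The vertex to be occupied next. -/
def next : CompState n → NestedType n
  | tail u k h => ⟨(u, k), h⟩
  | cross u _ j _ h => ⟨(u, j), h⟩

theorem terr_subset_zone (s : CompState n) : s.terr ⊆ s.zone := by
  cases s with
  | tail => exact subset_rfl
  | cross => exact Set.subset_union_left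

theorem card_guard_le (s : CompState n) : s.guard.card ≤ 2 := by
  cases s with
  | tail u k _ =>
    exact (Finset.card_union_le _ _).trans (add_le_add (card_exitSet_le _) (card_prevSet_le _ _))
  | cross u _ _ _ _ =>
    exact (Finset.card_union_le _ _).trans (add_le_add (card_exitSet_le _)
      (Finset.card_singleton _).le)

theorem zone_closed (s : CompState n) :
    ∀ a ∈ s.zone, ∀ b, NestedAdj a b → b ∈ s.zone ∨ b ∈ (s.guard : Set NestedVertex) := by
  cases s with
  | tail u k _ =>
    exact fun a ha b hab => tailRegion_closed ha hab
  | cross u i j hij _ =>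
    rintro a (ha | ha) b hab
    · rcases region_cons_closed ha hab with h | rfl | ⟨-, rfl⟩
      · exact .inl (.inl h)
      · right
        simp [guard]
      · exact .inl (.inr (.inl ⟨rfl, hij⟩))
    · rcases tailRegion_closed ha hab with h | h
      · exact .inl (.inr h)
      · exact .inr h

theorem not_adj_terr (s : CompState n) :
    ∀ a ∈ s.zone, a ∉ s.terr → ∀ b, NestedAdj a b → b ∉ s.terr := by
  cases s with
  | tail u k _ => exact fun a ha ha' => (ha' ha).elim
  | cross u i j _ _ =>
    intro a ha ha' b hab
    exact tailRegion_not_adj_region (ha.resolve_left ha') ha' hab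

end CompState

/-- Three cops search the path of a region in its order, two of them guarding the exit of the region
and the last occupied vertex. When the robber has entered the subregion `(i, j) :: u` from the
`i`-th vertex, only the `j`-th vertex has to be occupied before the search of the subregion starts,
as the robber cannot return to the subregion from the rest of the path. -/
def nestedCompCertificate (n : ℕ) : CompCertificate (nestedDigraph n) 3 where
  State := CompState n
  guard s := trace n s.guard
  zone s := trace n s.zone
  terr s := trace n s.terr
  next := CompState.next
  card_le s := ncard_insert_trace_le _ _ s.card_guard_le
  next_mem s := by
    cases s with
    | tail u k _ => exact .inl ⟨rfl, le_rfl⟩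
    | cross u i j hij _ => exact .inr (.inl ⟨rfl, hij⟩)
  terr_subset s := Set.preimage_mono s.terr_subset_zone
  union_comp s _ hx _ := mem_of_reaches_of_closed (trace_closed s.zone_closed)
    (Set.preimage_mono s.terr_subset_zone) (fun a ha ha' b hab => s.not_adj_terr a.1 ha ha' b.1 hab)
    hx
  start w := by
    have h0 : NestedValid n ([], 0) :=
      w.2.of_suffix List.nil_suffix (Nat.zero_lt_of_lt w.2.2.2)
    refine ⟨.tail [] 0 h0, ?_, ?_⟩
    · simp [trace, CompState.guard, exitSet, prevSet]
    · change w.1 ∈ tailRegion [] 0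
      rw [tailRegion_zero]
      exact List.nil_suffix
  step := by
    rintro (⟨u, k, hv⟩ | ⟨u, i, j, hij, hv⟩) w hw hne
    · rcases mem_tailRegion_cases hw fun h => hne (Subtype.ext h) with h | ⟨j, h⟩
      · refine ⟨.tail u (k + 1) (hv.of_suffix List.suffix_rfl (w.2.lt_of_mem_tailRegion h)),
          trace_subset_insert ?_, trace_subset_diff (tailRegion_anti u k.le_succ)
            (notMem_tailRegion_succ u k), h⟩
        intro y
        simp only [CompState.guard, CompState.next, prevSet, Finset.mem_coe, Finset.mem_union,
          Finset.mem_singleton]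
        tauto
      · obtain ⟨hkj, hjn⟩ := w.2.of_cons_suffix h
        refine ⟨.cross u k j hkj (hv.of_suffix List.suffix_rfl hjn), trace_subset_insert ?_,
          trace_subset_diff (Set.union_subset (region_cons_subset_tailRegion u le_rfl)
            (tailRegion_anti u k.le_succ)) ?_, h⟩
        · intro y
          simp only [CompState.guard, CompState.next, Finset.mem_coe, Finset.mem_union,
            Finset.mem_singleton]
          tauto
        · rintro (h' | h')
          · exact notMem_region_cons _ _ _ h'
          · exact notMem_tailRegion_succ _ _ h'
    · refine ⟨.tail ((i, j) :: u) 0 (w.2.of_suffix hw (Nat.zero_lt_of_lt w.2.2.2)),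
        trace_subset_insert ?_, trace_subset_diff ?_ ?_, (tailRegion_zero _).ge hw⟩
      · intro y
        simp only [CompState.guard, CompState.next, exitSet, prevSet, Finset.mem_coe,
          Finset.mem_union, Finset.mem_singleton]
        tauto
      · exact (tailRegion_zero _).le.trans Set.subset_union_left
      · exact fun h => notMem_region_cons _ _ _ ((tailRegion_zero _).le h)

/-- The states of the cops in the reachability game on the nested digraph. In the state
`cross u i j k`, the robber has entered the subregion `(i, j) :: u`, and the cops are occupying the
vertices of the path of `u` between the `i`-th and the `j`-th vertex one by one, the `k`-th vertex
being the next one. -/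
inductive ReachState (n : ℕ)
  | tail (u : List (ℕ × ℕ)) (k : ℕ) (h : NestedValid n (u, k))
  | cross (u : List (ℕ × ℕ)) (i j k : ℕ) (hik : i ≤ k) (hkj : k < j)
      (h : NestedValid n (u, k + 1))

namespace ReachState

/-- The vertices that the cops keep occupied. -/
def guard : ReachState n → Finset NestedVertex
  | tail u k _ => exitSet u ∪ prevSet u k
  | cross u i _ k _ _ _ => exitSet u ∪ {(u, i), (u, k)}

/-- The vertices that the robber can reach. -/
def zone : ReachState n → Set NestedVertex
  | tail u k _ => tailRegion u k
  | cross u i j k _ _ _ => region ((i, j) :: u) ∪ tailRegion u (k + 1)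

/-- The vertex to be occupied next. -/
def next : ReachState n → NestedType n
  | tail u k h => ⟨(u, k), h⟩
  | cross u _ _ k _ _ h => ⟨(u, k + 1), h⟩

theorem card_guard_le (s : ReachState n) : s.guard.card ≤ 3 := by
  cases s with
  | tail u k _ =>
    exact (Finset.card_union_le _ _).trans
      ((add_le_add (card_exitSet_le _) (card_prevSet_le _ _)).trans (by norm_num))
  | cross u i _ k _ _ _ =>
    exact (Finset.card_union_le _ _).trans (add_le_add (card_exitSet_le _) Finset.card_le_two)

theorem zone_closed (s : ReachState n) :
    ∀ a ∈ s.zone, ∀ b, NestedAdj a b → b ∈ s.zone ∨ b ∈ (s.guard : Set NestedVertex) := by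
  cases s with
  | tail u k _ =>
    exact fun a ha b hab => tailRegion_closed ha hab
  | cross u i j k _ hkj _ =>
    rintro a (ha | ha) b hab
    · rcases region_cons_closed ha hab with h | rfl | ⟨-, rfl⟩
      · exact .inl (.inl h)
      · right
        simp [guard]
      · exact .inl (.inr (.inl ⟨rfl, hkj⟩))
    · rcases tailRegion_closed ha hab with h | h
      · exact .inl (.inr h)
      · right
        simp only [prevSet, guard, Finset.mem_coe, Finset.mem_union, Finset.mem_singleton,
          Finset.mem_insert] at h ⊢
        tauto

end ReachState

/-- In the reachability game, the robber may leave the subregion `(i, j) :: u` for the path of `u`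
beyond the `i`-th vertex. Four cops occupy the path from there up to the `j`-th vertex in its order,
with one more cop on the `i`-th vertex as long as the robber may be in the subregion. -/
def nestedReachCertificate (n : ℕ) : ReachCertificate (nestedDigraph n) 4 where
  State := ReachState n
  guard s := trace n s.guard
  zone s := trace n s.zone
  next := ReachState.next
  card_le s := ncard_insert_trace_le _ _ s.card_guard_le
  next_mem s := by
    cases s with
    | tail u k _ => exact .inl ⟨rfl, le_rfl⟩
    | cross u i j k hik hkj _ => exact .inr (.inl ⟨rfl, le_rfl⟩)
  closed s := trace_closed s.zone_closed
  start w := by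
    have h0 : NestedValid n ([], 0) :=
      w.2.of_suffix List.nil_suffix (Nat.zero_lt_of_lt w.2.2.2)
    refine ⟨.tail [] 0 h0, ?_, ?_⟩
    · simp [trace, ReachState.guard, exitSet, prevSet]
    · change w.1 ∈ tailRegion [] 0
      rw [tailRegion_zero]
      exact List.nil_suffix
  step := by
    -- Both kinds of states may be left by searching the rest of the path or by entering a
    -- subregion at the vertex that was occupied last.
    have key : ∀ (u : List (ℕ × ℕ)) (k : ℕ) (hv : NestedValid n (u, k)) (N : Finset NestedVertex)
        (Z : Set NestedVertex) (w : NestedType n), exitSet u ⊆ N → tailRegion u k ⊆ Z →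
        w.1 ∈ tailRegion u k → w.1 ≠ (u, k) →
        ∃ s' : ReachState n, trace n s'.guard ⊆ insert ⟨(u, k), hv⟩ (trace n N) ∧
          trace n s'.zone ⊆ trace n Z \ {⟨(u, k), hv⟩} ∧ w ∈ trace n s'.zone := by
      intro u k hv N Z w hN hZ hw hne
      rcases mem_tailRegion_cases hw hne with h | ⟨j, h⟩
      · refine ⟨.tail u (k + 1) (hv.of_suffix List.suffix_rfl (w.2.lt_of_mem_tailRegion h)),
          trace_subset_insert ?_, trace_subset_diff ((tailRegion_anti u k.le_succ).trans hZ)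
            (notMem_tailRegion_succ u k), h⟩
        intro y hy
        simp only [ReachState.guard, prevSet, Finset.mem_coe, Finset.mem_union,
          Finset.mem_singleton] at hy
        exact hy.symm.imp_right fun h => hN h
      · obtain ⟨hkj, hjn⟩ := w.2.of_cons_suffix h
        refine ⟨.cross u k j k le_rfl hkj (hv.of_suffix List.suffix_rfl (by omega)),
          trace_subset_insert ?_, trace_subset_diff (.trans (Set.union_subset
            (region_cons_subset_tailRegion u le_rfl) (tailRegion_anti u k.le_succ)) hZ) ?_, .inl h⟩
        · intro y hy
          simp only [ReachState.guard, Finset.mem_coe, Finset.mem_union, Finset.mem_insert,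
            Finset.mem_singleton, or_self] at hy
          exact hy.symm.imp_right fun h => hN h
        · rintro (h' | h')
          · exact notMem_region_cons _ _ _ h'
          · exact notMem_tailRegion_succ _ _ h'
    rintro (⟨u, k, hv⟩ | ⟨u, i, j, k, hik, hkj, hv⟩) w hw hne
    · exact key u k hv _ _ w Finset.subset_union_left subset_rfl hw fun h => hne (Subtype.ext h)
    · rcases hw with hw | hw
      · obtain ⟨hij, hjn⟩ := w.2.of_cons_suffix hw
        rcases (show k + 1 ≤ j from hkj).eq_or_lt with rfl | hlt
        · refine ⟨.tail ((i, k + 1) :: u) 0 (w.2.of_suffix hw (by omega)),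
            trace_subset_insert ?_, trace_subset_diff ?_ ?_, (tailRegion_zero _).ge hw⟩
          · intro y
            simp only [ReachState.guard, ReachState.next, exitSet, prevSet, Finset.mem_coe,
              Finset.mem_union, Finset.mem_singleton, Finset.mem_insert]
            tauto
          · exact (tailRegion_zero _).le.trans Set.subset_union_left
          · exact fun h => notMem_region_cons _ _ _ ((tailRegion_zero _).le h)
        · refine ⟨.cross u i j (k + 1) (by omega) hlt (hv.of_suffix List.suffix_rfl (by omega)),
            trace_subset_insert ?_, trace_subset_diff
              (Set.union_subset_union_right _ (tailRegion_anti u (by omega))) ?_, .inl hw⟩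
          · intro y
            simp only [ReachState.guard, ReachState.next, Finset.mem_coe, Finset.mem_union,
              Finset.mem_insert, Finset.mem_singleton]
            tauto
          · rintro (h' | h')
            · exact notMem_region_cons _ _ _ h'
            · exact notMem_tailRegion_succ _ _ h'
      · exact key u (k + 1) hv _ _ w Finset.subset_union_left Set.subset_union_right hw
          fun h => hne (Subtype.ext h)

/-- The guard of the tail that starts with a vertex bounds the support of that vertex in the order
by decreasing nesting depth and decreasing position on the path. -/
theorem exists_tail_separation (v : NestedType n) : ∃ Z N : Set (NestedType n), v ∈ Z ∧
    (∀ a ∈ Z, ∀ b, (nestedDigraph n).Adj a b → b ∈ Z ∪ N) ∧ N.ncard ≤ 2 ∧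
    (∀ z ∈ Z, z = v ∨ v.1.1.length * n + v.1.2 < z.1.1.length * n + z.1.2) ∧
    ∀ z ∈ N, z.1.1.length * n + z.1.2 < v.1.1.length * n + v.1.2 := by
  obtain ⟨⟨u, k⟩, hv⟩ := v
  let s : CompState n := .tail u k hv
  have deeper : ∀ a b c d : ℕ, a < b → c < n → a * n + c < b * n + d := by
    intro a b c d hab hc
    have := Nat.mul_le_mul_right n (Nat.succ_le_of_lt hab)
    rw [Nat.succ_mul] at this
    omega
  refine ⟨trace n s.zone, trace n s.guard, .inl ⟨rfl, le_rfl⟩, trace_closed s.zone_closed, ?_,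
    ?_, ?_⟩
  · have h := Set.ncard_image_of_injective (trace n (s.guard : Set NestedVertex))
      Subtype.val_injective
    rw [← h]
    refine (Set.ncard_le_ncard (Set.image_preimage_subset _ _) s.guard.finite_toSet).trans ?_
    rw [Set.ncard_coe_finset]
    exact s.card_guard_le
  · rintro ⟨⟨w, l⟩, hz⟩ (⟨h1, h2⟩ | ⟨i, j, h1, h2⟩)
    · obtain rfl : w = u := h1
      rcases (show k ≤ l from h2).eq_or_lt with rfl | h
      · exact .inl rfl
      · exact .inr (Nat.add_lt_add_left h _)
    · exact .inr (deeper _ _ _ _ h2.length_le hv.2.2)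
  · rintro ⟨z, hz⟩ hzs
    have hzs : z ∈ exitSet u ∪ prevSet u k := hzs
    rcases u with _ | ⟨⟨i, j⟩, u⟩ <;> rcases k with _ | k <;>
      simp only [exitSet, prevSet, Finset.mem_union, Finset.mem_singleton, Finset.notMem_empty,
        or_false, false_or] at hzs
    · subst hzs
      simp
    · rcases hzs with rfl | rfl <;> exact deeper _ _ _ _ (by simp) hz.2.2
    · rcases hzs with rfl | rfl
      · exact deeper _ _ _ _ (by simp) hz.2.2
      · simp

end NestedStrategies

/-! ### Connected sets of nodes of a tree -/

section Trees

variable {N : Type} {T : SimpleGraph N}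

/-- A path inside a connected set of nodes. -/
theorem exists_isPath_support_subset {A : Set N} (hA : (T.induce A).Preconnected) {x y : N}
    (hx : x ∈ A) (hy : y ∈ A) : ∃ p : T.Walk x y, p.IsPath ∧ ∀ z ∈ p.support, z ∈ A := by
  classical
  obtain ⟨q⟩ := hA ⟨x, hx⟩ ⟨y, hy⟩
  let q' : T.Walk x y := q.map (SimpleGraph.Embedding.induce A).toHom
  refine ⟨q'.bypass, q'.bypass_isPath, fun z hz => ?_⟩
  have h : z ∈ q'.support := q'.support_bypass_subset_support hz
  rw [show q'.support = _ from SimpleGraph.Walk.support_map .., List.mem_map] at h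
  obtain ⟨a, -, rfl⟩ := h
  exact a.2

/-- In a forest, connected sets of nodes are closed under intersection. -/
theorem preconnected_induce_inter (hT : T.IsAcyclic) {A B : Set N}
    (hA : (T.induce A).Preconnected) (hB : (T.induce B).Preconnected) :
    (T.induce (A ∩ B)).Preconnected := by
  rintro ⟨x, hxA, hxB⟩ ⟨y, hyA, hyB⟩
  obtain ⟨p, hp, hpA⟩ := exists_isPath_support_subset hA hxA hyA
  obtain ⟨q, hq, hqB⟩ := exists_isPath_support_subset hB hxB hyB
  have hpq : p = q := congrArg Subtype.val
    ((hT.subsingleton_path x y).elim (⟨p, hp⟩ : T.Path x y) ⟨q, hq⟩)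
  exact ⟨p.induce (A ∩ B) fun z hz => ⟨hpA z hz, hqB z (hpq ▸ hz)⟩⟩

theorem reachable_deleteEdges_of_notMem {A : Set N} (hA : (T.induce A).Preconnected) {e v x y : N}
    (hev : e ∉ A ∨ v ∉ A) (hx : x ∈ A) (hy : y ∈ A) :
    (T.deleteEdges {s(e, v)}).Reachable x y := by
  refine SimpleGraph.Reachable.map (G := T.induce A)
    (⟨Subtype.val, fun {a b} hab => ?_⟩ : T.induce A →g T.deleteEdges {s(e, v)})
    (hA ⟨x, hx⟩ ⟨y, hy⟩)
  rw [SimpleGraph.deleteEdges_adj]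
  refine ⟨hab, fun h => ?_⟩
  rcases Sym2.eq_iff.1 (Set.mem_singleton_iff.1 h) with ⟨h1, h2⟩ | ⟨h1, h2⟩
  · exact hev.elim (fun h => h (h1 ▸ a.2)) fun h => h (h2 ▸ b.2)
  · exact hev.elim (fun h => h (h2 ▸ b.2)) fun h => h (h1 ▸ a.2)

/-- Every walk that ends outside a set `W` either avoids `W` or leaves it a last time. -/
theorem exists_last_exit {W : Set N} {x c : N} (p : T.Walk x c) (hc : c ∉ W) :
    (∃ q : T.Walk x c, ∀ z ∈ q.support, z ∉ W) ∨
      ∃ e ∈ W, ∃ v, T.Adj e v ∧ ∃ q : T.Walk v c, ∀ z ∈ q.support, z ∉ W := by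
  induction p with
  | nil => exact .inl ⟨.nil, by simpa using hc⟩
  | @cons x y c h p ih =>
    rcases ih hc with ⟨q, hq⟩ | h'
    · by_cases hx : x ∈ W
      · exact .inr ⟨x, hx, y, h, q, hq⟩
      · exact .inl ⟨.cons h q, by simpa [hx] using hq⟩
    · exact .inr h'

/-- Of two disjoint connected sets of nodes of a tree, the first has a gate towards the second: a
node of the first set that lies in every connected set meeting both. -/
theorem exists_gate (hT : T.IsTree) {W C : Set N} (hW : (T.induce W).Preconnected)
    (hC : (T.induce C).Preconnected) (hWne : W.Nonempty) (hCne : C.Nonempty) (hWC : Disjoint W C) :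
    ∃ e ∈ W, ∀ S : Set N, (T.induce S).Preconnected → (S ∩ W).Nonempty → (S ∩ C).Nonempty →
      e ∈ S := by
  obtain ⟨w, hw⟩ := hWne
  obtain ⟨c, hc⟩ := hCne
  obtain ⟨p⟩ := hT.connected.preconnected w c
  rcases exists_last_exit p (Set.disjoint_right.1 hWC hc) with ⟨q, hq⟩ | ⟨e, he, v, hev, q, hq⟩
  · exact (hq w q.start_mem_support hw).elim
  refine ⟨e, he, fun S hS => ?_⟩
  rintro ⟨x, hxS, hxW⟩ ⟨y, hyS, hyC⟩
  by_contra heS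
  -- The edge from `e` to `v` separates the two sets, but the connected set `S` avoids it.
  have hvW : v ∉ W := hq v q.start_mem_support
  have h1 := reachable_deleteEdges_of_notMem (e := e) hW (.inr hvW) he hxW
  have h2 := reachable_deleteEdges_of_notMem (v := v) hS (.inl heS) hxS hyS
  have h3 := reachable_deleteEdges_of_notMem (v := v) hC (.inl (Set.disjoint_left.1 hWC he)) hyC hc
  have h4 : (T.deleteEdges {s(e, v)}).Reachable v c := by
    refine ⟨q.toDeleteEdges _ fun f hf hf' => ?_⟩
    rw [Set.mem_singleton_iff] at hf'
    exact hq e (q.fst_mem_support_of_mem_edges (hf' ▸ hf)) he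
  exact SimpleGraph.isBridge_iff.1
    (SimpleGraph.isAcyclic_iff_forall_adj_isBridge.1 hT.isAcyclic hev)
    (((h1.trans h2).trans h3).trans h4.symm)

theorem inter_nonempty_of_pairwise (hT : T.IsTree) {A B C : Set N}
    (hA : (T.induce A).Preconnected) (hB : (T.induce B).Preconnected)
    (hC : (T.induce C).Preconnected) (hAB : (A ∩ B).Nonempty) (hAC : (A ∩ C).Nonempty)
    (hBC : (B ∩ C).Nonempty) : (C ∩ (A ∩ B)).Nonempty := by
  by_contra hne
  obtain ⟨e, he, h⟩ := exists_gate hT hC (preconnected_induce_inter hT.isAcyclic hA hB)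
    (hAC.mono Set.inter_subset_right) hAB (Set.disjoint_iff_inter_eq_empty.2
      (Set.not_nonempty_iff_eq_empty.1 hne))
  exact hne ⟨e, he, h A hA hAC (hAB.mono fun x hx => ⟨hx.1, hx⟩),
    h B hB hBC (hAB.mono fun x hx => ⟨hx.2, hx⟩)⟩

/-- The Helly property of connected sets of nodes of a tree. -/
theorem exists_mem_of_pairwise_inter (hT : T.IsTree) {ι : Type} (s : Finset ι) (f : ι → Set N)
    (hf : ∀ i ∈ s, (T.induce (f i)).Preconnected)
    (hs : ∀ i ∈ s, ∀ j ∈ s, (f i ∩ f j).Nonempty) : ∃ t, ∀ i ∈ s, t ∈ f i := by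
  classical
  induction s using Finset.induction_on generalizing f with
  | empty =>
    obtain ⟨t⟩ := hT.connected.nonempty
    exact ⟨t, by simp⟩
  | insert a s _ ih =>
    have ha := Finset.mem_insert_self a s
    have hs' : ∀ i ∈ s, i ∈ insert a s := fun i hi => Finset.mem_insert_of_mem hi
    rcases s.eq_empty_or_nonempty with rfl | ⟨b, hb⟩
    · obtain ⟨t, ht, -⟩ := hs a ha a ha
      exact ⟨t, by simpa using ht⟩
    · obtain ⟨t, ht⟩ := ih (fun i => f i ∩ f a)
        (fun i hi => preconnected_induce_inter hT.isAcyclic (hf i (hs' i hi)) (hf a ha))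
        (fun i hi j hj => by
          obtain ⟨t, h1, h2, h3⟩ := inter_nonempty_of_pairwise hT (hf i (hs' i hi))
            (hf j (hs' j hj)) (hf a ha) (hs i (hs' i hi) j (hs' j hj)) (hs i (hs' i hi) a ha)
            (hs j (hs' j hj) a ha)
          exact ⟨t, ⟨h2, h1⟩, h3, h1⟩)
      refine ⟨t, fun i hi => ?_⟩
      rcases Finset.mem_insert.1 hi with rfl | hi
      · exact (ht b hb).2
      · exact (ht i hi).1

end Trees

/-! ### D-decompositions -/

section DDecompositions

variable {G : Digraph V}

theorem Reaches.of_adj {S : Set V} {a b : V} (ha : a ∈ S) (hb : b ∈ S) (h : G.Adj a b) :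
    Reaches G Sᶜ a b :=
  ⟨fun h => h ha, .single ⟨h, fun h => h hb⟩⟩

theorem IsStronglyConnectedSet.of_center {S : Set V} {c : V} (hc : c ∈ S)
    (h : ∀ x ∈ S, Reaches G Sᶜ c x ∧ Reaches G Sᶜ x c) : IsStronglyConnectedSet G S :=
  ⟨⟨c, hc⟩, fun x hx y hy => (h x hx).2.trans (h y hy).1⟩

theorem IsStronglyConnectedSet.singleton (x : V) : IsStronglyConnectedSet G {x} := by
  refine .of_center rfl fun y hy => ?_
  obtain rfl : y = x := hy
  exact ⟨.refl (by simp), .refl (by simp)⟩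

theorem IsStronglyConnectedSet.image {W : Type} {H : Digraph W} {f : V → W}
    (hf : ∀ a b, G.Adj a b → H.Adj (f a) (f b)) {S : Set V} (hS : IsStronglyConnectedSet G S) :
    IsStronglyConnectedSet H (f '' S) := by
  refine ⟨hS.1.image f, ?_⟩
  rintro _ ⟨x, hx, rfl⟩ _ ⟨y, hy, rfl⟩
  refine ⟨fun h => h ⟨x, hx, rfl⟩, (hS.2 x hx y hy).2.lift f fun a b hab => ⟨hf a b hab.1, ?_⟩⟩
  exact fun h => h ⟨b, Set.notMem_compl_iff.1 hab.2, rfl⟩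

/-- The nodes whose bags meet the set `S`. -/
def DDecomposition.nodes (D : DDecomposition G) (S : Set V) : Set D.Node :=
  {t | (D.bag t ∩ S).Nonempty}

theorem DDecomposition.nodes_preconnected (D : DDecomposition G) {S : Set V}
    (hS : IsStronglyConnectedSet G S) : (D.tree.induce (D.nodes S)).Preconnected :=
  (D.connected S hS).preconnected

theorem DDecomposition.exists_mem_nodes (D : DDecomposition G) (x : V) :
    ∃ t, ∀ S, x ∈ S → t ∈ D.nodes S := by
  obtain ⟨t, ht⟩ := D.cover x
  exact ⟨t, fun S hx => ⟨x, ht, hx⟩⟩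

theorem DDecomposition.ncard_bag_le_width [Finite V] (D : DDecomposition G) (t : D.Node) :
    (D.bag t).ncard ≤ D.width :=
  Finset.le_sup (f := fun t => (D.bag t).ncard) (Finset.mem_univ t)

/-- The restriction of a D-decomposition to a subgraph. -/
def DDecomposition.comap {W : Type} {H : Digraph W} (D : DDecomposition H) (f : V → W)
    (hf : ∀ a b, G.Adj a b → H.Adj (f a) (f b)) : DDecomposition G where
  Node := D.Node
  tree := D.tree
  isTree := D.isTree
  root := D.root
  bag t := f ⁻¹' D.bag t
  cover v := D.cover (f v)
  connected S hS := by
    have h : {t | (f ⁻¹' D.bag t ∩ S).Nonempty} = {t | (D.bag t ∩ f '' S).Nonempty} := by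
      ext t
      simp only [Set.mem_ofPred_eq, ← Set.image_preimage_inter, Set.image_nonempty]
    exact h ▸ D.connected (f '' S) (hS.image hf)

theorem DDecomposition.width_comap_le [Finite V] {W : Type} [Finite W] {H : Digraph W}
    (D : DDecomposition H) {f : V → W} (hf : ∀ a b, G.Adj a b → H.Adj (f a) (f b))
    (hinj : f.Injective) : (D.comap f hf).width ≤ D.width := by
  refine Finset.sup_le fun t _ => le_trans ?_ (D.ncard_bag_le_width t)
  rw [← Set.ncard_image_of_injective _ hinj]
  exact Set.ncard_le_ncard (Set.image_preimage_subset _ _) (Set.toFinite _)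

/-- The D-decomposition with a single bag. -/
def DDecomposition.trivial (G : Digraph V) : DDecomposition G where
  Node := Unit
  tree := ⊥
  isTree := .of_subsingleton
  root := ()
  bag _ := Set.univ
  cover v := ⟨(), Set.mem_univ v⟩
  connected S hS := by
    have : Nonempty {t : Unit | (Set.univ ∩ S).Nonempty} := ⟨⟨(), by simpa using hS.1⟩⟩
    exact ⟨SimpleGraph.Preconnected.of_subsingleton⟩

theorem le_dWidth [Finite V] {k : ℕ} (h : ∀ D : DDecomposition G, k ≤ D.width) : k ≤ dWidth G := by
  obtain ⟨D, hD⟩ := Nat.sInf_mem (s := {w | ∃ D : DDecomposition G, D.width = w})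
    ⟨_, DDecomposition.trivial G, rfl⟩
  exact (h D).trans hD.le

/-- A set that contains a vertex of each of `n` disjoint kinds has at least `n` elements. -/
theorem le_ncard_of_forall_fin [Finite V] {n : ℕ} {s : Set V} (P : ℕ → V → Prop)
    (h : ∀ i < n, ∃ x ∈ s, P i x) (hP : ∀ i j x, P i x → P j x → i = j) : n ≤ s.ncard := by
  choose f hfs hf using fun i : Fin n => h i i.2
  have hinj : f.Injective := fun i j hij => Fin.ext (hP _ _ (f i) (hf i) (hij ▸ hf j))
  calc n = (Set.range f).ncard := by
        rw [← Set.image_univ, Set.ncard_image_of_injective _ hinj, Set.ncard_univ, Nat.card_fin]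
    _ ≤ s.ncard := Set.ncard_le_ncard (Set.range_subset_iff.2 hfs) (Set.toFinite _)

end DDecompositions

/-! ### Strongly connected sets of the nested digraph -/

section StronglyConnected

variable {n : ℕ}

theorem reaches_path {S : Set (NestedType n)} {u : List (ℕ × ℕ)} {a b : ℕ} (hab : a ≤ b)
    (hS : ∀ m, a ≤ m → m ≤ b → ∀ h, (⟨(u, m), h⟩ : NestedType n) ∈ S)
    (ha : NestedValid n (u, a)) (hb : NestedValid n (u, b)) :
    Reaches (nestedDigraph n) Sᶜ ⟨(u, a), ha⟩ ⟨(u, b), hb⟩ ∧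
      Reaches (nestedDigraph n) Sᶜ ⟨(u, b), hb⟩ ⟨(u, a), ha⟩ := by
  induction b, hab using Nat.le_induction with
  | base => exact ⟨.refl fun h => h (hS a le_rfl le_rfl _), .refl fun h => h (hS a le_rfl le_rfl _)⟩
  | succ b hab ih =>
    have hb' : NestedValid n (u, b) := ⟨hb.1, hb.2.1, (Nat.lt_succ_self b).trans hb.2.2⟩
    obtain ⟨h1, h2⟩ := ih (fun m h1 h2 => hS m h1 (h2.trans b.le_succ)) hb'
    have m1 := hS b hab b.le_succ hb'
    have m2 := hS (b + 1) (hab.trans b.le_succ) le_rfl hb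
    exact ⟨h1.trans (.of_adj m1 m2 (.up u b)), .trans (.of_adj m2 m1 (.down u b)) h2⟩

/-- Inside a region, the first vertex of its path reaches every vertex and is reached from it. -/
theorem region_center {u : List (ℕ × ℕ)} (hu : NestedValid n (u, 0)) (x : NestedType n)
    (hx : x ∈ trace n (region u)) :
    Reaches (nestedDigraph n) (trace n (region u))ᶜ ⟨(u, 0), hu⟩ x ∧
      Reaches (nestedDigraph n) (trace n (region u))ᶜ x ⟨(u, 0), hu⟩ := by
  obtain ⟨⟨w, l⟩, hv⟩ := x
  obtain ⟨t, rfl : t ++ u = w⟩ := hx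
  have mem : ∀ (t : List (ℕ × ℕ)) (l : ℕ) (h : NestedValid n (t ++ u, l)),
      (⟨(t ++ u, l), h⟩ : NestedType n) ∈ trace n (region u) := fun t l h => ⟨t, rfl⟩
  induction t generalizing l with
  | nil => exact reaches_path (Nat.zero_le l) (fun m _ _ h => mem [] m h) hu hv
  | cons p t ih =>
    obtain ⟨i, j⟩ := p
    obtain ⟨hij, hjn⟩ := hv.of_cons_suffix (i := i) (j := j) (u := t ++ u) List.suffix_rfl
    have h0 : NestedValid n ((i, j) :: t ++ u, 0) :=
      hv.of_suffix List.suffix_rfl (Nat.zero_lt_of_lt hjn)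
    have hi : NestedValid n (t ++ u, i) := hv.of_suffix (List.suffix_cons _ _) (hij.trans hjn)
    obtain ⟨h1, h2⟩ := ih i hi
    refine ⟨h1.trans (.of_adj (mem t i hi) (mem _ l hv) (.enter l List.suffix_rfl)), ?_⟩
    exact ((reaches_path (Nat.zero_le l) (fun m _ _ h => mem _ m h) h0 hv).2.trans
      (.of_adj (mem _ 0 h0) (mem t i hi) (.back _ hij))).trans h2

theorem isStronglyConnectedSet_region {u : List (ℕ × ℕ)} (hu : NestedValid n (u, 0)) :
    IsStronglyConnectedSet (nestedDigraph n) (trace n (region u)) :=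
  .of_center (c := ⟨(u, 0), hu⟩) List.suffix_rfl (region_center hu)

/-- The `i`-th vertex of the path of `u` together with all subregions attached to it. -/
def starSet (u : List (ℕ × ℕ)) (i : ℕ) : Set NestedVertex :=
  {x | x = (u, i) ∨ ∃ j, x ∈ region ((i, j) :: u)}

theorem eq_of_mem_starSet {u : List (ℕ × ℕ)} {i j : ℕ} {x : NestedVertex} (hi : x ∈ starSet u i)
    (hj : x ∈ starSet u j) : i = j := by
  rcases hi with rfl | ⟨k, hi⟩ <;> rcases hj with h | ⟨l, hj⟩
  · exact (Prod.mk.inj h).2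
  · exact (notMem_region_cons _ _ _ hj).elim
  · exact (notMem_region_cons _ _ _ (h ▸ hi)).elim
  · have h := List.suffix_or_suffix_of_suffix hi hj
    rw [List.suffix_cons_iff, List.suffix_cons_iff] at h
    rcases h with (h | h) | (h | h)
    · exact congrArg Prod.fst (List.cons.inj h).1
    · exact (not_cons_suffix h).elim
    · exact (congrArg Prod.fst (List.cons.inj h).1).symm
    · exact (not_cons_suffix h).elim

theorem isStronglyConnectedSet_starSet {u : List (ℕ × ℕ)} {i : ℕ} (hu : NestedValid n (u, i)) :
    IsStronglyConnectedSet (nestedDigraph n) (trace n (starSet u i)) := by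
  have hc : (⟨(u, i), hu⟩ : NestedType n) ∈ trace n (starSet u i) := .inl rfl
  refine .of_center hc ?_
  rintro ⟨x, hv⟩ (hx | ⟨j, hx⟩)
  · obtain rfl : x = (u, i) := hx
    exact ⟨.refl fun h => h hc, .refl fun h => h hc⟩
  · obtain ⟨hij, hjn⟩ := hv.of_cons_suffix hx
    have h0 : NestedValid n ((i, j) :: u, 0) := hv.of_suffix hx (Nat.zero_lt_of_lt hjn)
    refine ⟨.of_adj hc (.inr ⟨j, hx⟩) (.enter x.2 hx), ?_⟩
    refine ((region_center h0 ⟨x, hv⟩ hx).2.anti (Set.compl_subset_compl.2 fun y hy =>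
      .inr ⟨j, hy⟩)).trans ?_
    exact .of_adj (.inr ⟨j, List.suffix_rfl⟩) hc (.back u hij)

/-- A closed walk through a vertex `(u, k)`: through the exits of the surrounding regions it leads
to the exit `(v, j)` of the region `(i, j) :: v`, from there along the path of `v` to its `i`-th
vertex, and back to `(u, k)`. -/
def loopSet (u v : List (ℕ × ℕ)) (i j k : ℕ) : Set NestedVertex :=
  {x | x = (u, k) ∨ (∃ a b w, (a, b) :: w <:+ u ∧ (i, j) :: v <:+ (a, b) :: w ∧ x = (w, b)) ∨
    x.1 = v ∧ i ≤ x.2 ∧ x.2 ≤ j}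

theorem isStronglyConnectedSet_loopSet {u v : List (ℕ × ℕ)} {i j k : ℕ}
    (hu : NestedValid n (u, k)) (huv : (i, j) :: v <:+ u) :
    IsStronglyConnectedSet (nestedDigraph n) (trace n (loopSet u v i j k)) := by
  obtain ⟨hij, hjn⟩ := hu.of_cons_suffix huv
  have hvu : v <:+ u := (List.suffix_cons _ _).trans huv
  have hj : NestedValid n (v, j) := hu.of_suffix hvu hjn
  have hi : NestedValid n (v, i) := hu.of_suffix hvu (hij.trans hjn)
  have mj : (⟨(v, j), hj⟩ : NestedType n) ∈ trace n (loopSet u v i j k) :=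
    .inr (.inr ⟨rfl, hij.le, le_rfl⟩)
  have mi : (⟨(v, i), hi⟩ : NestedType n) ∈ trace n (loopSet u v i j k) :=
    .inr (.inr ⟨rfl, le_rfl, hij.le⟩)
  have path : ∀ l, i ≤ l → l ≤ j → ∀ h : NestedValid n (v, l),
      Reaches (nestedDigraph n) (trace n (loopSet u v i j k))ᶜ ⟨(v, l), h⟩ ⟨(v, j), hj⟩ ∧
      Reaches (nestedDigraph n) (trace n (loopSet u v i j k))ᶜ ⟨(v, j), hj⟩ ⟨(v, l), h⟩ :=
    fun l hil hlj h =>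
      reaches_path hlj (fun m hm hm' _ => .inr (.inr ⟨rfl, hil.trans hm, hm'⟩)) h hj
  have fwd : ∀ x ∈ trace n (loopSet u v i j k), (i, j) :: v <:+ x.1.1 →
      Reaches (nestedDigraph n) (trace n (loopSet u v i j k))ᶜ ⟨(v, j), hj⟩ x := fun x hx h =>
    (path i le_rfl hij.le hi).2.trans (.of_adj mi hx (.enter x.1.2 h))
  have bwd : ∀ (w : List (ℕ × ℕ)) (l : ℕ) (h : NestedValid n (w, l)),
      ⟨(w, l), h⟩ ∈ trace n (loopSet u v i j k) → (i, j) :: v <:+ w → w <:+ u →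
      Reaches (nestedDigraph n) (trace n (loopSet u v i j k))ᶜ ⟨(w, l), h⟩ ⟨(v, j), hj⟩ := by
    intro w
    induction w with
    | nil => exact fun l h _ hs => absurd hs.length_le (by simp)
    | cons p w ih =>
      obtain ⟨a, b⟩ := p
      intro l h hm hs hwu
      obtain ⟨hab, hbn⟩ := h.of_cons_suffix (i := a) (j := b) (u := w) List.suffix_rfl
      have hb : NestedValid n (w, b) := h.of_suffix (List.suffix_cons _ _) hbn
      have mb : (⟨(w, b), hb⟩ : NestedType n) ∈ trace n (loopSet u v i j k) :=
        .inr (.inl ⟨a, b, w, hwu, hs, rfl⟩)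
      have hadj : Reaches (nestedDigraph n) (trace n (loopSet u v i j k))ᶜ ⟨(_, l), h⟩
          ⟨(w, b), hb⟩ := .of_adj hm mb (.leave w l hab)
      rcases List.suffix_cons_iff.1 hs with h1 | h1
      · obtain ⟨h2, rfl⟩ := List.cons.inj h1
        obtain ⟨rfl, rfl⟩ := Prod.mk.inj h2
        exact hadj
      · exact hadj.trans (ih b hb mb h1 ((List.suffix_cons _ _).trans hwu))
  refine .of_center mj fun x hx => ?_
  obtain ⟨⟨w, l⟩, hv⟩ := x
  have hx' := hx
  rcases hx' with hx' | ⟨a, b, w', h1, h2, hx'⟩ | ⟨hx', h1, h2⟩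
  · obtain ⟨rfl, rfl⟩ := Prod.mk.inj hx'
    exact ⟨fwd _ hx huv, bwd _ _ hv hx huv List.suffix_rfl⟩
  · obtain ⟨rfl, rfl⟩ := Prod.mk.inj hx'
    rcases List.suffix_cons_iff.1 h2 with h3 | h3
    · obtain ⟨h4, rfl⟩ := List.cons.inj h3
      obtain ⟨rfl, rfl⟩ := Prod.mk.inj h4
      exact (path j hij.le le_rfl hv).symm
    · exact ⟨fwd _ hx h3, bwd _ _ hv hx h3 ((List.suffix_cons _ _).trans h1)⟩
  · obtain rfl : w = v := hx'
    exact (path l h1 h2 hv).symm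

end StronglyConnected

/-! ### The D-width of the nested digraph -/

section DWidth

variable {n : ℕ}

/-- Unless the width is large, some subregion and its exit have no bag in common. Otherwise, the
connected sets of nodes that belong to the sets `starSet u i` intersect pairwise, and by the Helly
property a single bag meets all of these disjoint sets. -/
theorem exists_region_separated (D : DDecomposition (nestedDigraph n)) (hD : D.width < n)
    {u : List (ℕ × ℕ)} (hu : NestedValid n (u, 0)) :
    ∃ i j, i < j ∧ j < n ∧ ∀ t ∈ D.nodes (trace n (region ((i, j) :: u))),
      ∀ h, (⟨(u, j), h⟩ : NestedType n) ∉ D.bag t := by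
  by_contra! hcon
  have hv : ∀ i : Fin n, NestedValid n (u, i) := fun i => ⟨hu.1, hu.2.1, i.2⟩
  have hsc := fun i : Fin n => isStronglyConnectedSet_starSet (hv i)
  have hlt : ∀ i j : Fin n, i < j →
      (D.nodes (trace n (starSet u i)) ∩ D.nodes (trace n (starSet u j))).Nonempty := by
    intro i j hij
    obtain ⟨t, ⟨x, hxt, hx⟩, h, hj⟩ := hcon i j hij j.2
    exact ⟨t, ⟨x, hxt, .inr ⟨j, hx⟩⟩, ⟨_, hj, .inl rfl⟩⟩
  obtain ⟨t, ht⟩ := exists_mem_of_pairwise_inter D.isTree Finset.univ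
    (fun i : Fin n => D.nodes (trace n (starSet u i)))
    (fun i _ => D.nodes_preconnected (hsc i)) (fun i _ j _ => by
      rcases lt_trichotomy i j with h | rfl | h
      · exact hlt i j h
      · obtain ⟨t, ht⟩ := D.exists_mem_nodes ⟨(u, i), hv i⟩
        exact ⟨t, ht _ (.inl rfl), ht _ (.inl rfl)⟩
      · rw [Set.inter_comm]
        exact hlt j i h)
  have : n ≤ (D.bag t).ncard := by
    refine le_ncard_of_forall_fin (fun i x => x.1 ∈ starSet u i) (fun i hi => ?_)
      fun i j x => eq_of_mem_starSet
    obtain ⟨x, hx⟩ := ht ⟨i, hi⟩ (Finset.mem_univ _)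
    exact ⟨x, hx⟩
  exact absurd (this.trans (D.ncard_bag_le_width t)) (by omega)

/-- If the width is small, then there are nested regions of every depth such that the bags that meet
the innermost one contain none of the exits of all these regions. -/
theorem exists_nested_separated (D : DDecomposition (nestedDigraph n)) (hD : D.width < n) (m : ℕ)
    (hm : m ≤ n) : ∃ u : List (ℕ × ℕ), u.length = m ∧ NestedValid n (u, 0) ∧
      ∀ i j v, (i, j) :: v <:+ u → ∀ t ∈ D.nodes (trace n (region u)),
        ∀ h, (⟨(v, j), h⟩ : NestedType n) ∉ D.bag t := by
  induction m with
  | zero => exact ⟨[], rfl, ⟨by simp, by simp, by simp; omega⟩,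
      fun i j v h => absurd h.length_le (by simp)⟩
  | succ m ih =>
    obtain ⟨u, hlen, hu, hsep⟩ := ih (by omega)
    obtain ⟨i, j, hij, hjn, h⟩ := exists_region_separated D hD hu
    refine ⟨(i, j) :: u, by simp [hlen], ⟨by simp [hlen, hm], ?_, hu.2.2⟩, ?_⟩
    · intro p hp
      rcases List.mem_cons.1 hp with rfl | hp
      · exact ⟨hij, hjn⟩
      · exact hu.2.1 p hp
    · intro a b v hs t ht
      rcases List.suffix_cons_iff.1 hs with h1 | h1
      · obtain ⟨h2, rfl⟩ := List.cons.inj h1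
        obtain ⟨rfl, rfl⟩ := Prod.mk.inj h2
        exact h t ht
      · obtain ⟨x, hxt, hx⟩ := ht
        exact hsep a b v h1 t ⟨x, hxt, (List.suffix_cons _ _).trans hx⟩

/-- At the gate of the innermost of `n` nested regions towards its exit, the bag meets every closed
walk that passes through the region and its exit. As it contains none of the exits, it contains the
whole path of the region or a vertex of each of the `n` surrounding paths. -/
theorem le_width_nestedDigraph (D : DDecomposition (nestedDigraph n)) : n ≤ D.width := by
  by_contra! hD
  obtain ⟨u, hlen, hu, hsep⟩ := exists_nested_separated D hD n le_rfl
  obtain ⟨i, j, v, rfl⟩ : ∃ i j v, u = (i, j) :: v := by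
    rcases u with _ | ⟨⟨i, j⟩, v⟩
    · simp only [List.length_nil] at hlen
      omega
    · exact ⟨i, j, v, rfl⟩
  obtain ⟨hij, hjn⟩ := hu.of_cons_suffix (i := i) (j := j) (u := v) List.suffix_rfl
  have hj : NestedValid n (v, j) := hu.of_suffix (List.suffix_cons _ _) hjn
  obtain ⟨t₁, h₁⟩ := D.exists_mem_nodes ⟨((i, j) :: v, 0), hu⟩
  obtain ⟨t₂, h₂⟩ := D.exists_mem_nodes ⟨(v, j), hj⟩
  obtain ⟨e, he, hgate⟩ := exists_gate D.isTree
    (D.nodes_preconnected (isStronglyConnectedSet_region hu))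
    (D.nodes_preconnected (.singleton ⟨(v, j), hj⟩)) ⟨t₁, h₁ _ List.suffix_rfl⟩ ⟨t₂, h₂ _ rfl⟩ (by
      rw [Set.disjoint_left]
      rintro t ht ⟨x, hx, hxj⟩
      obtain rfl : x = _ := hxj
      exact hsep i j v List.suffix_rfl t ht hj hx)
  have hbag := D.ncard_bag_le_width e
  obtain ⟨k, hk, hke⟩ : ∃ k, ∃ h : NestedValid n ((i, j) :: v, k),
      (⟨((i, j) :: v, k), h⟩ : NestedType n) ∉ D.bag e := by
    by_contra! hall
    have : n ≤ (D.bag e).ncard := le_ncard_of_forall_fin (fun k x => x.1.2 = k)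
      (fun k hk => ⟨_, hall k ⟨hu.1, hu.2.1, hk⟩, rfl⟩) fun a b x h h' => h.symm.trans h'
    omega
  have : n ≤ (D.bag e).ncard := by
    refine le_ncard_of_forall_fin (fun m x => x.1.1.length = m) (fun m hm => ?_)
      fun a b x h h' => h.symm.trans h'
    -- The region of depth `m + 1` among the nested ones, with its surrounding path of depth `m`.
    obtain ⟨a, b, w, hw, hwm⟩ : ∃ a b w, (a, b) :: w <:+ (i, j) :: v ∧ w.length = m := by
      have hl : (((i, j) :: v).drop (n - 1 - m)).length = m + 1 := by
        rw [List.length_drop, hlen]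
        omega
      obtain ⟨⟨a, b⟩, w, hw⟩ := List.exists_cons_of_length_eq_add_one hl
      exact ⟨a, b, w, hw ▸ List.drop_suffix _ _, by rw [hw] at hl; simpa using hl⟩
    obtain ⟨t, ht⟩ := D.exists_mem_nodes ⟨((i, j) :: v, k), hk⟩
    obtain ⟨x, hxe, hx⟩ := hgate _ (D.nodes_preconnected (isStronglyConnectedSet_loopSet hk hw))
      ⟨t, ht _ (.inl rfl), ht _ List.suffix_rfl⟩
      ⟨t₂, h₂ _ (.inr (.inl ⟨i, j, v, List.suffix_rfl, hw, rfl⟩)), h₂ _ rfl⟩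
    obtain ⟨x, hv⟩ := x
    rcases hx with hx | ⟨c, d, w', hs, -, hx⟩ | ⟨hx, -, -⟩
    · obtain rfl : x = _ := hx
      exact (hke hxe).elim
    · obtain rfl : x = _ := hx
      exact (hsep c d w' hs e he _ hxe).elim
    · exact ⟨_, hxe, (congrArg List.length hx).trans hwm⟩
  omega

end DWidth

/-! ### The family of digraphs -/

/-- The digraphs that separate D-width from the other width measures. -/
def separatingDigraph (n : ℕ) : Digraph (NestedType n ⊕ Fin 5) :=
  disjSum (nestedDigraph n) smallDigraph

theorem not_separatingDigraph_adj_self (n : ℕ) (v : NestedType n ⊕ Fin 5) :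
    ¬ (separatingDigraph n).Adj v v := by
  rcases v with v | v
  · exact fun h => not_nestedAdj_self v.1 ((disjSum_adj_inl (G := nestedDigraph n)).1 h)
  · exact fun h => (disjSum_adj_inr.1 h).1 rfl

theorem kellyWidth_separatingDigraph (n : ℕ) [Fintype (NestedType n ⊕ Fin 5)] :
    kellyWidth (separatingDigraph n) = 4 := by
  refine kellyWidth_eq (k := 3) (exists_eliminationWidth_le
    (Sum.elim (fun v => v.1.1.length * n + v.1.2) fun i => i) ?_) fun L => ?_
  · rintro (v | i)
    · obtain ⟨Z, N, hv, hcl, hN, hZ, hNv⟩ := exists_tail_separation v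
      refine ⟨Sum.inl '' Z, Sum.inl '' N, ⟨v, hv, rfl⟩, closed_inl hcl, ?_, ?_, ?_⟩
      · rw [Set.ncard_image_of_injective _ Sum.inl_injective]
        omega
      · rintro _ ⟨z, hz, rfl⟩
        exact (hZ z hz).imp_left (congrArg _)
      · rintro _ ⟨z, hz, rfl⟩
        exact hNv z hz
    · refine ⟨Sum.inr '' smallReachCertificate.zone i, Sum.inr '' smallReachCertificate.guard i,
        ⟨i, le_refl i, rfl⟩, closed_inr (smallReachCertificate.closed i), ?_, ?_, ?_⟩
      · rw [Set.ncard_image_of_injective _ Sum.inr_injective]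
        change ((smallGuard i : Finset (Fin 5)) : Set (Fin 5)).ncard ≤ 3
        rw [Set.ncard_coe_finset]
        revert i
        decide
      · rintro _ ⟨z, hz, rfl⟩
        rcases (show i ≤ z from hz).eq_or_lt with rfl | h
        · exact .inl rfl
        · exact .inr h
      · rintro _ ⟨z, hz, rfl⟩
        exact (Finset.mem_filter.1 (Finset.mem_coe.1 hz)).2.1
  · refine le_eliminationWidth_of_outdegree Sum.inr Sum.inr_injective (fun w => ?_) L
    obtain ⟨t, h1, h2, h3⟩ := smallDigraph_outdegree w
    exact ⟨t, h1, h2, fun x hx => disjSum_adj_inr.2 (h3 x hx)⟩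

theorem le_dWidth_separatingDigraph (n : ℕ) [Finite (NestedType n ⊕ Fin 5)] :
    n ≤ dWidth (separatingDigraph n) :=
  le_dWidth fun D => (le_width_nestedDigraph _).trans
    (D.width_comap_le (f := Sum.inl) (fun _ _ h => disjSum_adj_inl.2 h) Sum.inl_injective)

end DigraphWidth

theorem mainTheorem6 :
    ∃ (V : ℕ → Type) (_ : ∀ n, Fintype (V n)) (G : ∀ n, Digraph (V n)), ∀ n : ℕ,
      (∀ v, ¬ (G n).Adj v v) ∧
      DigraphWidth.CopsWinDirectedTreeWidthGame (G n) 3 ∧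
      DigraphWidth.CopsWinDAGWidthGame (G n) 4 ∧
      DigraphWidth.kellyWidth (G n) = 4 ∧
      n ≤ DigraphWidth.dWidth (G n) := by
  have fin : ∀ n, Fintype (DigraphWidth.NestedType n ⊕ Fin 5) := fun n => Fintype.ofFinite _
  exact ⟨_, fin, DigraphWidth.separatingDigraph, fun n =>
    ⟨DigraphWidth.not_separatingDigraph_adj_self n,
      ((DigraphWidth.nestedCompCertificate n).sum DigraphWidth.smallCompCertificate).copsWin,
      ((DigraphWidth.nestedReachCertificate n).sum DigraphWidth.smallReachCertificate).copsWin,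
      DigraphWidth.kellyWidth_separatingDigraph n, DigraphWidth.le_dWidth_separatingDigraph n⟩⟩
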